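/- Let $d\ge 1$ and let $g$ be a probability density on $\mathbb{R}^d$ with $g\in L_\infty(\mathbb{R}^d)$ whose characteristic function $G(\eta)=\int_{\mathbb{R}^d}e^{i\eta^\top x}g(x)\,dx$ is Lipschitz continuous on every compact subset of $\mathbb{R}^d$. *Mixture class.* Let $K_{\mathcal G},K_{\mathcal L}\ge 0$ be integers. For parameters $\theta=(\beta_k^{\mathcal G},\mu_k,\Sigma_k;\beta_\ell^{\mathcal L},\nu_\ell,\Lambda_\ell)$ put $$\widehat g(x;\theta)=\sum_{k=1}^{K_{\mathcal G}}\beta_k^{\mathcal G}\,\frac{e^{-\frac12(x-\mu_k)^\top\Sigma_k^{-1}(x-\mu_k)}}{(2\pi)^{d/2}|\Sigma_k|^{1/2}}+\sum_{\ell=1}^{K_{\mathcal L}}\beta_\ell^{\mathcal L}\,\frac{r_\ell(x)^{1-d/2}K_{d/2-1}(r_\ell(x))}{(2\pi)^{d/2}|\Lambda_\ell|^{1/2}},\qquad r_\ell(x)=\sqrt{(x-\nu_\ell)^\top\Lambda_\ell^{-1}(x-\nu_\ell)},$$ where $K_\alpha$ is the modified Bessel function of the second kind, and $$\widehat G(\eta;\theta)=\sum_{k}\beta_k^{\mathcal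 G}e^{i\eta^\top\mu_k-\frac12\eta^\top\Sigma_k\eta}+\sum_\ell\beta_\ell^{\mathcal L}\frac{e^{i\eta^\top\nu_\ell}}{1+\eta^\top\Lambda_\ell\eta}.$$ Let $\Theta$ be the set of all $\theta$ with nonnegative weights summing to one, $|\mu_k|,|\nu_\ell|\le\overline\mu$, and symmetric matrices with $\sigma_{\min}^2I\preceq\Sigma_k\preceq\sigma_{\max}^2I$ and $b_{\min}^2I\preceq\Lambda_\ell\preceq b_{\max}^2I$, where $\sigma_{\min},b_{\min}>0$. *Tail condition.* For $\eta',\varepsilon>0$ let $T(\eta',\varepsilon)$ denote the condition that $\int_{\mathbb{R}^d\setminus[-\eta',\eta']^d}|G|^2\,d\eta\le\varepsilon$ and $\int_{\mathbb{R}^d\setminus[-\eta',\eta']^d}|\widehat G(\eta;\theta)|^2\,d\eta\le\varepsilon$ for all $\theta\in\Theta$. If $d\le 3$ or $K_{\mathcal L}=0$, then for every $\varepsilon>0$ the condition $T(\eta',\varepsilon)$ holds for all sufficiently large $\eta'$. *Training.* Let $P=n^d$. In each coordinate direction $j$ let $-\eta'=\xi^j_0<\dots<\xi^j_n=\eta'$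 be a partition with one node in each cell $[\xi^j_{i-1},\xi^j_i]$; the nodes $\eta_1,\dots,\eta_P$ are the points of the resulting tensor-product grid. Define $C_1$ by $\max_{j,i}(\xi^j_i-\xi^j_{i-1})=C_1/P^{1/d}$. Let $M\ge1$, let $X_1,\dots,X_M$ be i.i.d. with density $g$, let $\widehat G_M(\eta)=\frac1M\sum_{m}e^{i\eta^\top X_m}$, and for $\lambda\ge 0$ let $$\mathrm{Loss}(\theta)=\frac1P\sum_{p=1}^P\big(\Delta_{p,\mathrm{Re}}^2+\Delta_{p,\mathrm{Im}}^2\big)+\frac\lambda P\sum_{p=1}^P\big(|\Delta_{p,\mathrm{Re}}|+|\Delta_{p,\mathrm{Im}}|\big),$$ where $\Delta_{p,\mathrm{Re}}$ and $\Delta_{p,\mathrm{Im}}$ are the real and imaginary parts of $\widehat G_M(\eta_p)-\widehat G(\eta_p;\theta)$. Put $V_P^{(d)}=\frac1P\sum_p(1-|G(\eta_p)|^2)$ and $W_P^{(d)}=\frac1P\sum_p\sqrt{1-|G(\eta_p)|^2}$. *Error bound.* For every $\eta'>0$ there is a constant $C_d'=C_d'(\eta')>0$ (depending also on $g$ and $\Theta$,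 but not on $\varepsilon$, $P$, the grid, $C_1$, $M$, $\lambda$, $\varepsilon_1$, the sample or $\widehat\theta$) such that the following holds. Let $\varepsilon>0$ be such that $T(\eta',\varepsilon)$ holds, let $\widehat\Theta\subseteq\Theta$, let $\widehat\theta$ be a (random, sample-dependent) minimizer of $\mathrm{Loss}$ over $\widehat\Theta$, and suppose that $\mathrm{Loss}(\widehat\theta)\le\varepsilon_1$ almost surely for some $\varepsilon_1>0$. Then $$\mathbb{E}\Big[\int_{\mathbb{R}^d}|g(x)-\widehat g(x;\widehat\theta)|^2dx\Big]<\frac1{(2\pi)^d}\Big(4\varepsilon+C_1^d\big(2\varepsilon_1+\tfrac{2V_P^{(d)}}M+\lambda\sqrt{\tfrac2M}\,W_P^{(d)}\big)+\frac{C_d'C_1^{d+1}}{P^{1/d}}\Big).$$ Moreover $0\le V_P^{(d)}\le1$ and $0\le W_P^{(d)}\le 1$, and hence $$\mathbb{E}\Big[\int_{\mathbb{R}^d}|g(x)-\widehat g(x;\widehat\theta)|^2dx\Big]<\frac1{(2\pi)^d}\Big(4\varepsilon+C_1^d\big(2\varepsilon_1+\tfrac{2}M+\lambda\sqrt{\tfrac2M}\big)+\frac{C_d'C_1^{d+1}}{P^{1/d}}\Big).$$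 -/

import Mathlib

open MeasureTheory ProbabilityTheory
open scoped NNReal ENNReal

namespace FourierMixture

noncomputable section

/-- The space `ℝ^d` with its Euclidean norm. -/
abbrev Vec (d : ℕ) : Type := EuclideanSpace ℝ (Fin d)

/-- The quadratic form `vᵀ A v`. -/
def quadForm {d : ℕ} (A : Matrix (Fin d) (Fin d) ℝ) (v : Vec d) : ℝ :=
  WithLp.ofLp v ⬝ᵥ A.mulVec (WithLp.ofLp v)

/-- The characteristic function `G(η) = ∫ exp(i ηᵀx) g(x) dx` of a density `g`. -/
def densityCF {d : ℕ} (g : Vec d → ℝ) (η : Vec d) : ℂ :=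
  ∫ x : Vec d, Complex.exp (Complex.I * ((inner ℝ η x : ℝ) : ℂ)) * ((g x : ℝ) : ℂ)

/-- The empirical characteristic function of the data `x₁, …, x_M`. -/
def empiricalCF {d M : ℕ} (x : Fin M → Vec d) (η : Vec d) : ℂ :=
  (1 / (M : ℂ)) * ∑ m, Complex.exp (Complex.I * ((inner ℝ η (x m) : ℝ) : ℂ))

/-- The modified Bessel function of the second kind `K_α(z)` for `z > 0`, through the standard
integral representation `K_α(z) = ½ (z/2)^α ∫₀^∞ exp(-t - z²/(4t)) t^(-α-1) dt`,
valid for every real order `α`. -/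
def besselK (α z : ℝ) : ℝ :=
  (1 / 2) * (z / 2) ^ α *
    ∫ t in Set.Ioi (0 : ℝ), Real.exp (-t - z ^ 2 / (4 * t)) * t ^ (-α - 1)

/-- The Gaussian density with mean `μ` and covariance matrix `S`. -/
def gaussKernel {d : ℕ} (μ : Vec d) (S : Matrix (Fin d) (Fin d) ℝ) (x : Vec d) : ℝ :=
  1 / ((2 * Real.pi) ^ ((d : ℝ) / 2) * Real.sqrt S.det) *
    Real.exp (-(1 / 2) * quadForm S⁻¹ (x - μ))

/-- The elliptical radius `r(x; ν, L) = √((x - ν)ᵀ L⁻¹ (x - ν))`. -/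
def ellipticRadius {d : ℕ} (ν : Vec d) (L : Matrix (Fin d) (Fin d) ℝ) (x : Vec d) : ℝ :=
  Real.sqrt (quadForm L⁻¹ (x - ν))

/-- The elliptical Laplace density with location `ν` and scale matrix `L`. (Its value at the
single point `x = ν`, where the formula is singular, plays no role.) -/
def laplaceKernel {d : ℕ} (ν : Vec d) (L : Matrix (Fin d) (Fin d) ℝ) (x : Vec d) : ℝ :=
  1 / ((2 * Real.pi) ^ ((d : ℝ) / 2) * Real.sqrt L.det) *
    ellipticRadius ν L x ^ (1 - (d : ℝ) / 2) *
    besselK ((d : ℝ) / 2 - 1) (ellipticRadius ν L x)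

/-- Parameters of a mixture of `KG` Gaussian and `KL` elliptical Laplace components. -/
structure Param (d KG KL : ℕ) where
  weightG : Fin KG → ℝ
  locG : Fin KG → Vec d
  covG : Fin KG → Matrix (Fin d) (Fin d) ℝ
  weightL : Fin KL → ℝ
  locL : Fin KL → Vec d
  covL : Fin KL → Matrix (Fin d) (Fin d) ℝ

/-- The bounded parameter set `Θ`: weights are nonnegative and sum to one, locations have norm at
most `μbar`, and the matrices are symmetric with `σmin² I ≤ Σ_k ≤ σmax² I` and
`bmin² I ≤ Λ_l ≤ bmax² I` in the Loewner order (in dimension one: `σmin ≤ σ_k ≤ σmax` and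
`bmin ≤ b_l ≤ bmax` where `Σ_k = σ_k²`, `Λ_l = b_l²`). -/
def paramSet (d KG KL : ℕ) (μbar σmin σmax bmin bmax : ℝ) : Set (Param d KG KL) :=
  {θ | (∀ k, 0 ≤ θ.weightG k) ∧ (∀ l, 0 ≤ θ.weightL l) ∧
    ∑ k, θ.weightG k + ∑ l, θ.weightL l = 1 ∧
    (∀ k, ‖θ.locG k‖ ≤ μbar) ∧ (∀ l, ‖θ.locL l‖ ≤ μbar) ∧
    (∀ k, (θ.covG k - σmin ^ 2 • (1 : Matrix (Fin d) (Fin d) ℝ)).PosSemidef) ∧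
    (∀ k, (σmax ^ 2 • (1 : Matrix (Fin d) (Fin d) ℝ) - θ.covG k).PosSemidef) ∧
    (∀ l, (θ.covL l - bmin ^ 2 • (1 : Matrix (Fin d) (Fin d) ℝ)).PosSemidef) ∧
    (∀ l, (bmax ^ 2 • (1 : Matrix (Fin d) (Fin d) ℝ) - θ.covL l).PosSemidef)}

/-- The mixture density `ĝ(x; θ)`. -/
def mixtureDensity {d KG KL : ℕ} (θ : Param d KG KL) (x : Vec d) : ℝ :=
  ∑ k, θ.weightG k * gaussKernel (θ.locG k) (θ.covG k) x +
    ∑ l, θ.weightL l * laplaceKernel (θ.locL l) (θ.covL l) x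

/-- The learned characteristic function `Ĝ(η; θ)` in closed form. -/
def mixtureCF {d KG KL : ℕ} (θ : Param d KG KL) (η : Vec d) : ℂ :=
  ∑ k, (θ.weightG k : ℂ) *
      Complex.exp (Complex.I * ((inner ℝ η (θ.locG k) : ℝ) : ℂ)
        - (1 / 2) * ((quadForm (θ.covG k) η : ℝ) : ℂ)) +
    ∑ l, (θ.weightL l : ℂ) *
      (Complex.exp (Complex.I * ((inner ℝ η (θ.locL l) : ℝ) : ℂ)) /
        (1 + ((quadForm (θ.covL l) η : ℝ) : ℂ)))

/-- The cube `[-R, R]^d`. -/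
def cube (d : ℕ) (R : ℝ) : Set (Vec d) := {η | ∀ j, |η j| ≤ R}

/-- The squared `L₂`-mass of `H` outside `[-R, R]^d`. -/
def tailMass {d : ℕ} (H : Vec d → ℂ) (R : ℝ) : ℝ≥0∞ :=
  ∫⁻ η in (cube d R)ᶜ, ‖H η‖ₑ ^ 2

/-- A tensor-product grid on `[-R, R]^d` with `n` cells in each coordinate direction, and one
node in each of these cells. -/
structure TensorGrid (d n : ℕ) (R : ℝ) where
  /-- the partition points `-R = ξ_0 < ξ_1 < ⋯ < ξ_n = R` in direction `j` -/
  pt : Fin d → Fin (n + 1) → ℝ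
  pt_strictMono : ∀ j, StrictMono (pt j)
  pt_zero : ∀ j, pt j 0 = -R
  pt_last : ∀ j, pt j (Fin.last n) = R
  /-- the node chosen in each cell in direction `j` -/
  node : Fin d → Fin n → ℝ
  node_mem : ∀ j i, node j i ∈ Set.Icc (pt j i.castSucc) (pt j i.succ)

/-- The nodes in `ℝ^d`; there are `n ^ d` of them, indexed by `Fin d → Fin n`. -/
def TensorGrid.nodeVec {d n : ℕ} {R : ℝ} (Γ : TensorGrid d n R) (p : Fin d → Fin n) : Vec d :=
  WithLp.toLp 2 (fun j => Γ.node j (p j))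

/-- The largest cell width `δ_max` over all coordinate directions. -/
def TensorGrid.maxWidth {d n : ℕ} {R : ℝ} (Γ : TensorGrid d n R) : ℝ :=
  ⨆ q : Fin d × Fin n, (Γ.pt q.1 q.2.succ - Γ.pt q.1 q.2.castSucc)

/-- The average of `f` over the `P = n ^ d` nodes of the grid. -/
def TensorGrid.mean {d n : ℕ} {R : ℝ} (Γ : TensorGrid d n R) (f : Vec d → ℝ) : ℝ :=
  (1 / ((n ^ d : ℕ) : ℝ)) * ∑ p : Fin d → Fin n, f (Γ.nodeVec p)

/-- The training loss: the mean squared error plus `lam` times the mean absolute error of the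
real and imaginary residuals at the nodes. -/
def trainLoss {d n M KG KL : ℕ} {R : ℝ} (Γ : TensorGrid d n R) (lam : ℝ) (x : Fin M → Vec d)
    (θ : Param d KG KL) : ℝ :=
  Γ.mean (fun η =>
      ((empiricalCF x η).re - (mixtureCF θ η).re) ^ 2 +
        ((empiricalCF x η).im - (mixtureCF θ η).im) ^ 2) +
    lam * Γ.mean (fun η =>
      |(empiricalCF x η).re - (mixtureCF θ η).re| +
        |(empiricalCF x η).im - (mixtureCF θ η).im|)

/-- `V_P = (1/P) ∑_p (1 - |G(η_p)|²)`. -/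
def gridV {d n : ℕ} {R : ℝ} (Γ : TensorGrid d n R) (G : Vec d → ℂ) : ℝ :=
  Γ.mean (fun η => 1 - ‖G η‖ ^ 2)

/-- `W_P = (1/P) ∑_p √(1 - |G(η_p)|²)`. -/
def gridW {d n : ℕ} {R : ℝ} (Γ : TensorGrid d n R) (G : Vec d → ℂ) : ℝ :=
  Γ.mean (fun η => Real.sqrt (1 - ‖G η‖ ^ 2))

/-- The squared `L₂` distance of two real functions on `ℝ^d`, with values in `[0, ∞]`. -/
def sqL2Dist {d : ℕ} (f h : Vec d → ℝ) : ℝ≥0∞ :=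
  ∫⁻ x : Vec d, ENNReal.ofReal (|f x - h x| ^ 2)

end

end FourierMixture

/-! By Plancherel the squared distance of `g` and the mixture is (2π)^(-d) times that of their
characteristic functions, once the closed form `mixtureCF` is known to be the transform of
`mixtureDensity`. For Gaussians this is a linear change of variables; an elliptical Laplace density
is the mixture over t of Gaussians with covariance 2tΛ and weight e^(-t), so its transform is an
exponential integral with value 1/(1 + ηᵀΛη) up to a phase.

Frequency space is split at the cube. Outside it, |a - b|² ≤ 2|a|² + 2|b|² and the tail condition
give 4ε. Inside it, the difference of characteristic functions is bounded by 2 and Lipschitz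
uniformly in θ (`norm_mixtureCF_sub_le`), so its squared norm integrates to at most a Riemann sum at
the nodes plus a term linear in the mesh (`setLIntegral_cube_le`). At the nodes the empirical
characteristic function is inserted: its distance to the model is controlled by the loss, and its
mean squared distance to G is (1 - |G|²)/M, a sum of two variances.

The penalty with factor λ only helps: it is dropped from the loss, and the W-term of the bound is
nonnegative slack. Strictness comes from enlarging the constant of the mesh term by one.

For the tail condition, the functions `mixtureCF θ` have a common square-integrable majorant, and G
is square integrable because `g` is bounded and integrable. -/

namespace FourierMixture

/-! ### Plancherel's identity for integrable functions, with values in [0, ∞] -/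

section Plancherel

open scoped FourierTransform ContDiff SchwartzMap

variable {V : Type*} [NormedAddCommGroup V] [InnerProductSpace ℝ V] [FiniteDimensional ℝ V]
  [MeasurableSpace V] [BorelSpace V]

lemma continuous_fourier_of_integrable {f : V → ℂ} (hf : Integrable f) : Continuous (𝓕 f) :=
  VectorFourier.fourierIntegral_continuous Real.continuous_fourierChar
    (by exact continuous_inner) hf

/-- The multiplication formula, by Fubini. It links the Fourier integral of an integrable function
with the distributional transform on L². -/
lemma integral_fourier_smul_eq_of_integrable (φ : 𝓢(V, ℂ)) {f : V → ℂ} (hf : Integrable f) :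
    ∫ ξ, (𝓕 φ) ξ • f ξ = ∫ x, φ x • 𝓕 f x := by
  have := VectorFourier.integral_fourierIntegral_smul_eq_flip (L := innerₗ V)
    Real.continuous_fourierChar continuous_inner (φ.integrable (μ := volume)) hf
  rw [flip_innerₗ] at this
  exact this

/-- Real bump functions, viewed as complex Schwartz functions, already separate locally integrable
functions. -/
lemma ae_eq_of_forall_schwartz {f h : V → ℂ} (hf : LocallyIntegrable f) (hh : LocallyIntegrable h)
    (H : ∀ φ : 𝓢(V, ℂ), ∫ x, φ x • f x = ∫ x, φ x • h x) : f =ᵐ[volume] h := by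
  refine ae_eq_of_integral_contDiff_smul_eq hf hh fun φ hφ hc ↦ ?_
  have h₁ : HasCompactSupport (Complex.ofRealCLM ∘ φ) := hc.comp_left rfl
  have h₂ : ContDiff ℝ ∞ (Complex.ofRealCLM ∘ φ) := by fun_prop
  simpa using H (h₁.toSchwartzMap h₂)

/-- An integrable function with square integrable Fourier transform is square integrable, with
the same `L²` norm. -/
lemma plancherel_of_memLp_fourier {f : V → ℂ} (hf : Integrable f) (hF : MemLp (𝓕 f) 2) :
    eLpNorm f 2 volume = eLpNorm (𝓕 f) 2 volume := by
  set F : Lp ℂ 2 (volume : Measure V) := hF.toLp (𝓕 f) with hFdef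
  set h : Lp ℂ 2 (volume : Measure V) := 𝓕⁻ F with hh
  -- Fourier inversion in the weak sense: tested on φ, the L² inverse transform h gives ∫ 𝓕⁻φ · 𝓕f,
  -- which the multiplication formula turns into ∫ φ f. The L² isometry then compares the norms.
  have key : f =ᵐ[volume] h := by
    refine ae_eq_of_forall_schwartz hf.locallyIntegrable
      ((Lp.memLp h).locallyIntegrable one_le_two) fun φ ↦ ?_
    have h1 : (h : 𝓢'(V, ℂ)) φ = (F : 𝓢'(V, ℂ)) (𝓕⁻ φ) := by
      rw [hh, ← Lp.fourierInv_toTemperedDistribution_eq, TemperedDistribution.fourierInv_apply]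
    rw [Lp.toTemperedDistribution_apply, Lp.toTemperedDistribution_apply] at h1
    rw [h1]
    have h2 := integral_fourier_smul_eq_of_integrable (𝓕⁻ φ) hf
    rw [FourierTransform.fourier_fourierInv_eq] at h2
    rw [h2]
    refine integral_congr_ae ?_
    filter_upwards [hF.coeFn_toLp] with x hx
    rw [hFdef, hx]
  rw [eLpNorm_congr_ae key, ← eLpNorm_congr_ae hF.coeFn_toLp, ← hFdef]
  have : ‖h‖ = ‖F‖ := by
    rw [← Lp.norm_fourier_eq h, hh, FourierTransform.fourier_fourierInv_eq]
  rw [Lp.norm_def, Lp.norm_def] at this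
  exact (ENNReal.toReal_eq_toReal_iff' (Lp.eLpNorm_ne_top _) (Lp.eLpNorm_ne_top _)).1 this

/-- The Fourier transform of a function in `L¹ ∩ L²` is square integrable. -/
lemma memLp_fourier_of_memLp {f : V → ℂ} (hf : Integrable f) (hf2 : MemLp f 2) :
    MemLp (𝓕 f) 2 := by
  set F : Lp ℂ 2 (volume : Measure V) := hf2.toLp f with hFdef
  set h : Lp ℂ 2 (volume : Measure V) := 𝓕 F with hh
  have key : 𝓕 f =ᵐ[volume] h := by
    refine ae_eq_of_forall_schwartz (continuous_fourier_of_integrable hf).locallyIntegrable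
      ((Lp.memLp h).locallyIntegrable one_le_two) fun φ ↦ ?_
    have h1 : (h : 𝓢'(V, ℂ)) φ = (F : 𝓢'(V, ℂ)) (𝓕 φ) := by
      rw [hh, ← Lp.fourier_toTemperedDistribution_eq, TemperedDistribution.fourier_apply]
    rw [Lp.toTemperedDistribution_apply, Lp.toTemperedDistribution_apply] at h1
    rw [h1, ← integral_fourier_smul_eq_of_integrable φ hf]
    refine integral_congr_ae ?_
    filter_upwards [hf2.coeFn_toLp] with x hx
    rw [hFdef, hx]
  exact (memLp_congr_ae key).2 (Lp.memLp h)

lemma lintegral_enorm_sq_eq_eLpNorm {f : V → ℂ} :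
    ∫⁻ x, ‖f x‖ₑ ^ 2 = eLpNorm f 2 volume ^ 2 := by
  rw [eLpNorm_eq_lintegral_rpow_enorm_toReal two_ne_zero ENNReal.ofNat_ne_top, ← ENNReal.rpow_natCast,
    ← ENNReal.rpow_mul]
  simp

/-- Square integrability of either side implies that of the other, so the remaining case is ∞ = ∞.
Assuming only integrability matters because Laplace densities need not be square integrable in high
dimension. -/
theorem lintegral_enorm_sq_fourier {f : V → ℂ} (hf : Integrable f) :
    ∫⁻ x, ‖𝓕 f x‖ₑ ^ 2 = ∫⁻ x, ‖f x‖ₑ ^ 2 := by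
  rw [lintegral_enorm_sq_eq_eLpNorm, lintegral_enorm_sq_eq_eLpNorm]
  by_cases hF : MemLp (𝓕 f) 2
  · rw [plancherel_of_memLp_fourier hf hF]
  · have hf2 : ¬ MemLp f 2 := fun h ↦ hF (memLp_fourier_of_memLp hf h)
    have e1 : eLpNorm (𝓕 f) 2 volume = ⊤ := by
      by_contra hne
      exact hF ⟨(continuous_fourier_of_integrable hf).aestronglyMeasurable, lt_top_iff_ne_top.2 hne⟩
    have e2 : eLpNorm f 2 volume = ⊤ := by
      by_contra hne
      exact hf2 ⟨hf.aestronglyMeasurable, lt_top_iff_ne_top.2 hne⟩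
    rw [e1, e2]

end Plancherel

/-! ### Characteristic functions as rescaled Fourier transforms -/

section DensityCF

open scoped FourierTransform

variable {d : ℕ}

/-- The kernel of `𝓕` is exp(-2πi⟨x, w⟩), whence the dilation by -1/(2π); it produces the factor
(2π)^d in Plancherel's identity. -/
lemma densityCF_eq_fourier (g : Vec d → ℝ) (η : Vec d) :
    densityCF g η = 𝓕 (fun x ↦ (g x : ℂ)) ((-(2 * Real.pi)⁻¹) • η) := by
  rw [Real.fourier_eq', densityCF]
  refine integral_congr_ae (ae_of_all _ fun x ↦ ?_)
  simp only [smul_eq_mul]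
  congr 2
  rw [inner_smul_right, real_inner_comm, mul_comm]
  congr 2
  field_simp

lemma continuous_densityCF {g : Vec d → ℝ} (hg : Integrable g) : Continuous (densityCF g) := by
  have : densityCF g = fun η ↦ 𝓕 (fun x ↦ (g x : ℂ)) ((-(2 * Real.pi)⁻¹) • η) :=
    funext (densityCF_eq_fourier g)
  rw [this]
  exact (continuous_fourier_of_integrable hg.ofReal).comp (continuous_const_smul _)

lemma lintegral_comp_smul_vec {f : Vec d → ℝ≥0∞} (hf : Measurable f) {r : ℝ} (hr : r ≠ 0) :
    ∫⁻ x, f (r • x) = ENNReal.ofReal |(r ^ d)⁻¹| * ∫⁻ x, f x := by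
  have h := Measure.map_addHaar_smul (volume : Measure (Vec d)) hr
  rw [finrank_euclideanSpace_fin] at h
  rw [← lintegral_map hf (measurable_const_smul r), h, lintegral_smul_measure, smul_eq_mul]

/-- Plancherel's identity for the characteristic function of an integrable function. -/
theorem lintegral_enorm_sq_densityCF {g : Vec d → ℝ} (hg : Integrable g) :
    ∫⁻ η, ‖densityCF g η‖ₑ ^ 2 = ENNReal.ofReal ((2 * Real.pi) ^ d) * ∫⁻ x, ‖g x‖ₑ ^ 2 := by
  have hc := continuous_fourier_of_integrable (hg.ofReal (𝕜 := ℂ))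
  simp_rw [densityCF_eq_fourier]
  rw [lintegral_comp_smul_vec (f := fun w ↦ ‖𝓕 (fun x ↦ (g x : ℂ)) w‖ₑ ^ 2)
    (hc.measurable.enorm.pow_const 2) (by simp [Real.pi_ne_zero]),
    lintegral_enorm_sq_fourier (f := fun x ↦ (g x : ℂ)) hg.ofReal]
  have h : |((-(2 * Real.pi)⁻¹) ^ d)⁻¹| = (2 * Real.pi) ^ d := by
    rw [abs_inv, abs_pow, abs_neg, abs_of_pos (by positivity), inv_pow, inv_inv]
  rw [h]
  congr 1
  refine lintegral_congr fun x ↦ ?_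
  rw [← ofReal_norm, ← ofReal_norm, Complex.norm_real]

lemma densityCF_sub {f g : Vec d → ℝ} (hf : Integrable f) (hg : Integrable g) (η : Vec d) :
    densityCF (fun x ↦ f x - g x) η = densityCF f η - densityCF g η := by
  have hb : ∀ {h : Vec d → ℝ}, Integrable h → Integrable fun x : Vec d ↦
      Complex.exp (Complex.I * ((inner ℝ η x : ℝ) : ℂ)) * ((h x : ℝ) : ℂ) := fun hh ↦
    hh.ofReal.bdd_mul (c := 1) (by fun_prop) (ae_of_all _ fun x ↦ by
      rw [mul_comm, Complex.norm_exp_ofReal_mul_I])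
  rw [densityCF, densityCF, densityCF, ← integral_sub (hb hf) (hb hg)]
  congr 1
  funext x
  push_cast
  ring

end DensityCF

/-! ### Gaussian densities and their characteristic functions -/

section Gaussian

variable {d : ℕ}

/-- Positivity in the Loewner order gives S = BᵀB, and A is Bᵀ. The substitution x = Ay then turns
the Gaussian with covariance S into the standard one. -/
lemma exists_eq_mul_transpose_of_posDef {S : Matrix (Fin d) (Fin d) ℝ} (hS : S.PosDef) :
    ∃ A : Matrix (Fin d) (Fin d) ℝ, S = A * A.transpose ∧ A.det ≠ 0 ∧ √S.det = |A.det| := by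
  open scoped MatrixOrder in
  obtain ⟨B, hB⟩ := CStarAlgebra.nonneg_iff_eq_star_mul_self.1 hS.posSemidef.nonneg
  have hdet : S.det = B.det ^ 2 := by
    rw [hB, Matrix.det_mul, Matrix.star_eq_conjTranspose, Matrix.det_conjTranspose]
    simp [sq]
  refine ⟨B.transpose, by simpa [Matrix.star_eq_conjTranspose] using hB, ?_, ?_⟩
  · rw [Matrix.det_transpose]
    have := hS.det_pos
    intro h
    rw [hdet, h] at this
    simp at this
  · rw [hdet, Real.sqrt_sq_eq_abs, Matrix.det_transpose]

lemma quadForm_mul_transpose (A : Matrix (Fin d) (Fin d) ℝ) (η : Vec d) :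
    quadForm (A * A.transpose) η = ‖Matrix.toEuclideanLin A.transpose η‖ ^ 2 := by
  rw [quadForm, ← Matrix.mulVec_mulVec, Matrix.dotProduct_mulVec, ← Matrix.mulVec_transpose,
    EuclideanSpace.norm_sq_eq]
  simp [dotProduct, sq]

lemma quadForm_inv_mul_transpose {A : Matrix (Fin d) (Fin d) ℝ} (hA : A.det ≠ 0) (y : Vec d) :
    quadForm (A * A.transpose)⁻¹ (Matrix.toEuclideanLin A y) = ‖y‖ ^ 2 := by
  have hu : IsUnit A.det := hA.isUnit
  have hu' : IsUnit A.transpose.det := by rwa [Matrix.det_transpose]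
  rw [quadForm, Matrix.ofLp_toLpLin, Matrix.toLin'_apply, Matrix.mul_inv_rev,
    Matrix.mulVec_mulVec, Matrix.mul_assoc, Matrix.nonsing_inv_mul _ hu, Matrix.mul_one,
    dotProduct_comm, Matrix.dotProduct_mulVec, ← Matrix.mulVec_transpose, Matrix.mulVec_mulVec,
    Matrix.mul_nonsing_inv _ hu', Matrix.one_mulVec, EuclideanSpace.norm_sq_eq]
  simp [dotProduct, sq]

lemma inner_toEuclideanLin (A : Matrix (Fin d) (Fin d) ℝ) (η y : Vec d) :
    inner ℝ η (Matrix.toEuclideanLin A y) = inner ℝ (Matrix.toEuclideanLin A.transpose η) y := by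
  simp only [EuclideanSpace.inner_eq_star_dotProduct, Matrix.ofLp_toLpLin, Matrix.toLin'_apply,
    star_trivial]
  rw [dotProduct_comm, Matrix.dotProduct_mulVec, ← Matrix.mulVec_transpose, dotProduct_comm]

lemma measurableEmbedding_toEuclideanLin {A : Matrix (Fin d) (Fin d) ℝ} (hA : A.det ≠ 0) :
    MeasurableEmbedding (Matrix.toEuclideanLin A) := by
  have hdet : LinearMap.det (Matrix.toEuclideanLin A) ≠ 0 := by
    rwa [LinearMap.det_toLpLin]
  exact (LinearMap.continuous_of_finiteDimensional _).measurableEmbedding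
    (LinearMap.equivOfDetNeZero _ hdet).injective

lemma map_toEuclideanLin {A : Matrix (Fin d) (Fin d) ℝ} (hA : A.det ≠ 0) :
    Measure.map (Matrix.toEuclideanLin A) (volume : Measure (Vec d)) =
      ENNReal.ofReal |A.det|⁻¹ • volume := by
  have := Measure.map_linearMap_addHaar_eq_smul_addHaar (volume : Measure (Vec d))
    (f := Matrix.toEuclideanLin A) (by rwa [LinearMap.det_toLpLin])
  rw [this, LinearMap.det_toLpLin, abs_inv]

lemma integral_comp_toEuclideanLin {A : Matrix (Fin d) (Fin d) ℝ} (hA : A.det ≠ 0)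
    (F : Vec d → ℂ) :
    ∫ x, F x = (|A.det| : ℝ) • ∫ y, F (Matrix.toEuclideanLin A y) := by
  rw [← (measurableEmbedding_toEuclideanLin hA).integral_map, map_toEuclideanLin hA,
    integral_smul_measure, smul_smul, ENNReal.toReal_ofReal (by positivity),
    mul_inv_cancel₀ (by positivity), one_smul]

lemma integrable_comp_toEuclideanLin {A : Matrix (Fin d) (Fin d) ℝ} (hA : A.det ≠ 0)
    (F : Vec d → ℝ) (h : Integrable fun y ↦ F (Matrix.toEuclideanLin A y)) : Integrable F := by
  have := ((measurableEmbedding_toEuclideanLin hA).integrable_map_iff (μ := volume) (g := F)).2 h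
  rw [map_toEuclideanLin hA] at this
  exact (integrable_smul_measure (by simp [hA]) ENNReal.ofReal_ne_top).1 this

lemma gaussKernel_eq (μ : Vec d) (S : Matrix (Fin d) (Fin d) ℝ) (x : Vec d) :
    gaussKernel μ S x = gaussKernel 0 S (x - μ) := by
  simp [gaussKernel]

lemma gaussKernel_nonneg (μ : Vec d) (S : Matrix (Fin d) (Fin d) ℝ) (x : Vec d) :
    0 ≤ gaussKernel μ S x := by
  unfold gaussKernel; positivity

lemma integrable_gaussKernel {S : Matrix (Fin d) (Fin d) ℝ} (hS : S.PosDef) (μ : Vec d) :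
    Integrable (gaussKernel μ S) := by
  have h0 : Integrable (gaussKernel 0 S) := by
    obtain ⟨A, rfl, hA, hdet⟩ := exists_eq_mul_transpose_of_posDef hS
    refine Integrable.const_mul ?_ _
    refine integrable_comp_toEuclideanLin hA _ ?_
    simp only [sub_zero, quadForm_inv_mul_transpose hA]
    have := (GaussianFourier.integrable_cexp_neg_mul_sq_norm_add (b := 1 / 2) (V := Vec d)
      (by norm_num) 0 0).norm
    refine this.congr (ae_of_all _ fun v ↦ ?_)
    simp only [Complex.norm_exp]
    congr 1
    simp [← Complex.ofReal_pow]
  rw [funext (gaussKernel_eq μ S)]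
  exact h0.comp_sub_right μ

/-- The characteristic function of a nondegenerate Gaussian density. -/
theorem densityCF_gaussKernel {S : Matrix (Fin d) (Fin d) ℝ} (hS : S.PosDef) (μ η : Vec d) :
    densityCF (gaussKernel μ S) η =
      Complex.exp (Complex.I * ((inner ℝ η μ : ℝ) : ℂ)
        - (1 / 2) * ((quadForm S η : ℝ) : ℂ)) := by
  obtain ⟨A, rfl, hA, hdet⟩ := exists_eq_mul_transpose_of_posDef hS
  have hpi : (0 : ℝ) < (2 * Real.pi) ^ ((d : ℝ) / 2) := by positivity
  have hA' : (0 : ℝ) < |A.det| := by positivity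
  have hc : (((Real.pi : ℝ) : ℂ) / (1 / 2)) ^ ((Module.finrank ℝ (Vec d) : ℂ) / 2) =
      (((2 * Real.pi) ^ ((d : ℝ) / 2) : ℝ) : ℂ) := by
    rw [Complex.ofReal_cpow (by positivity), finrank_euclideanSpace_fin]
    push_cast
    congr 1
    ring
  -- Translating by μ and substituting Ay turns the exponent into -‖y‖²/2; the Jacobian |det A|
  -- cancels √det S in the normalization.
  rw [densityCF, ← integral_add_right_eq_self _ μ, integral_comp_toEuclideanLin hA]
  have key : ∀ y : Vec d,
      Complex.exp (Complex.I * ((inner ℝ η (Matrix.toEuclideanLin A y + μ) : ℝ) : ℂ)) *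
        ((gaussKernel μ (A * A.transpose) (Matrix.toEuclideanLin A y + μ) : ℝ) : ℂ) =
      (((2 * Real.pi) ^ ((d : ℝ) / 2) * |A.det| : ℝ) : ℂ)⁻¹ *
        Complex.exp (Complex.I * ((inner ℝ η μ : ℝ) : ℂ)) *
        Complex.exp (-(1 / 2) * (‖y‖ : ℂ) ^ 2 +
          Complex.I * ((inner ℝ (Matrix.toEuclideanLin A.transpose η) y : ℝ) : ℂ)) := by
    intro y
    rw [gaussKernel, add_sub_cancel_right, quadForm_inv_mul_transpose hA, hdet, inner_add_right,
      inner_toEuclideanLin]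
    push_cast
    rw [mul_add, Complex.exp_add, Complex.exp_add]
    ring
  simp_rw [key]
  rw [integral_const_mul, GaussianFourier.integral_cexp_neg_mul_sq_norm_add (by norm_num), hc,
    quadForm_mul_transpose, sub_eq_add_neg, Complex.exp_add, Complex.real_smul]
  have e : Complex.I ^ 2 * (‖Matrix.toEuclideanLin A.transpose η‖ : ℂ) ^ 2 / (4 * (1 / 2)) =
      -(1 / 2 * ((‖Matrix.toEuclideanLin A.transpose η‖ ^ 2 : ℝ) : ℂ)) := by
    rw [Complex.I_sq]
    push_cast
    ring
  rw [e]
  have h1 : ((((2 * Real.pi) ^ ((d : ℝ) / 2) : ℝ)) : ℂ) ≠ 0 := by exact_mod_cast hpi.ne'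
  have h2 : ((|A.det| : ℝ) : ℂ) ≠ 0 := by exact_mod_cast hA'.ne'
  rw [Complex.ofReal_mul]
  field_simp

end Gaussian

/-! ### Elliptical Laplace densities as exponential scale mixtures of Gaussians -/

section Laplace

variable {d : ℕ}

lemma continuous_quadForm (A : Matrix (Fin d) (Fin d) ℝ) :
    Continuous (quadForm A : Vec d → ℝ) := by
  unfold quadForm dotProduct Matrix.mulVec dotProduct
  fun_prop

lemma quadForm_smul_matrix (c : ℝ) (A : Matrix (Fin d) (Fin d) ℝ) (v : Vec d) :
    quadForm (c • A) v = c * quadForm A v := by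
  simp [quadForm, Matrix.smul_mulVec]

lemma densityCF_zero (g : Vec d → ℝ) : densityCF g 0 = ((∫ x, g x : ℝ) : ℂ) := by
  simp [densityCF, integral_complex_ofReal]

lemma quadForm_zero (A : Matrix (Fin d) (Fin d) ℝ) : quadForm A (0 : Vec d) = 0 := by
  simp [quadForm]

lemma integral_gaussKernel {S : Matrix (Fin d) (Fin d) ℝ} (hS : S.PosDef) (μ : Vec d) :
    ∫ x, gaussKernel μ S x = 1 := by
  have := densityCF_gaussKernel hS μ 0
  rw [densityCF_zero] at this
  simpa [quadForm_zero] using this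

lemma gaussKernel_smul (ν : Vec d) (L : Matrix (Fin d) (Fin d) ℝ) {t : ℝ} (ht : 0 < t)
    (hL : IsUnit L.det) (x : Vec d) :
    gaussKernel ν ((2 * t) • L) x =
      1 / ((2 * Real.pi) ^ ((d : ℝ) / 2) * ((2 * t) ^ ((d : ℝ) / 2) * √L.det)) *
        Real.exp (-(1 / 2) * ((2 * t)⁻¹ * quadForm L⁻¹ (x - ν))) := by
  have h2t : 0 < 2 * t := by positivity
  have e1 : √((2 * t) ^ d * L.det) = (2 * t) ^ ((d : ℝ) / 2) * √L.det := by
    rw [Real.sqrt_mul (by positivity), Real.sqrt_eq_rpow, ← Real.rpow_natCast,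
      ← Real.rpow_mul h2t.le]
    ring_nf
  have e2 : ((2 * t) • L)⁻¹ = (2 * t)⁻¹ • L⁻¹ := by
    simpa [Units.smul_def] using Matrix.inv_smul' L (Units.mk0 (2 * t) h2t.ne') hL
  rw [gaussKernel, Matrix.det_smul, Fintype.card_fin, e1, e2, quadForm_smul_matrix]

lemma quadForm_pos {S : Matrix (Fin d) (Fin d) ℝ} (hS : S.PosDef) {v : Vec d} (hv : v ≠ 0) :
    0 < quadForm S v := by
  have := hS.dotProduct_mulVec_pos (x := WithLp.ofLp v) (by simpa using hv)
  simpa [quadForm] using this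

/-- Inserting the integral representation of the Bessel function, the powers of r cancel, and the
integrand left over is e^(-t) times the Gaussian density with covariance 2tL. The point x = ν is
excluded since r = 0 there. -/
lemma laplaceKernel_eq_integral {L : Matrix (Fin d) (Fin d) ℝ} (hL : L.PosDef) {ν x : Vec d}
    (hx : x ≠ ν) :
    laplaceKernel ν L x =
      ∫ t in Set.Ioi (0 : ℝ), Real.exp (-t) * gaussKernel ν ((2 * t) • L) x := by
  have hq : 0 < quadForm L⁻¹ (x - ν) := quadForm_pos hL.inv (sub_ne_zero.2 hx)
  set r := ellipticRadius ν L x with hr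
  have hr0 : 0 < r := Real.sqrt_pos.2 hq
  have hr2 : quadForm L⁻¹ (x - ν) = r ^ 2 := (Real.sq_sqrt hq.le).symm
  have hdet : 0 < √L.det := Real.sqrt_pos.2 hL.det_pos
  have e0 : r ^ (1 - (d : ℝ) / 2) * (r / 2) ^ ((d : ℝ) / 2 - 1) = 2 ^ (1 - (d : ℝ) / 2) := by
    rw [Real.div_rpow hr0.le two_pos.le, ← mul_div_assoc, ← Real.rpow_add hr0]
    have : 1 - (d : ℝ) / 2 + ((d : ℝ) / 2 - 1) = 0 := by ring
    rw [this, Real.rpow_zero, one_div, ← Real.rpow_neg two_pos.le]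
    congr 1
    ring
  rw [laplaceKernel, besselK, ← hr]
  have e3 : ∀ I : ℝ, 1 / ((2 * Real.pi) ^ ((d : ℝ) / 2) * √L.det) * r ^ (1 - (d : ℝ) / 2) *
      (1 / 2 * (r / 2) ^ ((d : ℝ) / 2 - 1) * I) =
      1 / ((2 * Real.pi) ^ ((d : ℝ) / 2) * √L.det) * (2 ^ (1 - (d : ℝ) / 2) / 2) * I := by
    intro I
    rw [← e0]
    ring
  rw [e3, ← integral_const_mul]
  refine setIntegral_congr_fun measurableSet_Ioi fun t (ht : 0 < t) ↦ ?_
  rw [gaussKernel_smul ν L ht hL.det_pos.ne'.isUnit, hr2]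
  have e4 : t ^ (-((d : ℝ) / 2 - 1) - 1) = (t ^ ((d : ℝ) / 2))⁻¹ := by
    rw [← Real.rpow_neg ht.le]
    congr 1
    ring
  have e5 : (2 : ℝ) ^ (1 - (d : ℝ) / 2) / 2 = (2 ^ ((d : ℝ) / 2))⁻¹ := by
    rw [Real.rpow_sub two_pos, Real.rpow_one]
    field_simp
  have e6 : Real.exp (-t - r ^ 2 / (4 * t)) =
      Real.exp (-t) * Real.exp (-(1 / 2) * ((2 * t)⁻¹ * r ^ 2)) := by
    rw [← Real.exp_add]
    congr 1
    field_simp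
    ring
  rw [e4, e5, e6, Real.mul_rpow two_pos.le ht.le]
  have : 0 < (2 * Real.pi) ^ ((d : ℝ) / 2) := by positivity
  field_simp

lemma posDef_smul_of_pos {L : Matrix (Fin d) (Fin d) ℝ} (hL : L.PosDef) {t : ℝ} (ht : 0 < t) :
    ((2 * t) • L).PosDef :=
  hL.smul (by positivity)

/-- The explicit formula `gaussKernel_smul` is visibly jointly measurable, and it holds for t > 0,
hence almost everywhere for the restricted measure. -/
lemma aestronglyMeasurable_gaussMixing {L : Matrix (Fin d) (Fin d) ℝ} (hL : L.PosDef)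
    (ν : Vec d) :
    AEStronglyMeasurable
      (fun p : Vec d × ℝ ↦ Real.exp (-p.2) * gaussKernel ν ((2 * p.2) • L) p.1)
      (volume.prod (volume.restrict (Set.Ioi (0 : ℝ)))) := by
  have hq : Measurable fun p : Vec d × ℝ ↦ quadForm L⁻¹ (p.1 - ν) :=
    ((continuous_quadForm L⁻¹).comp (by fun_prop : Continuous fun p : Vec d × ℝ ↦ p.1 - ν)).measurable
  have hm : Measurable fun p : Vec d × ℝ ↦ Real.exp (-p.2) *
      (1 / ((2 * Real.pi) ^ ((d : ℝ) / 2) * ((2 * p.2) ^ ((d : ℝ) / 2) * √L.det)) *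
        Real.exp (-(1 / 2) * ((2 * p.2)⁻¹ * quadForm L⁻¹ (p.1 - ν)))) := by
    fun_prop
  refine hm.aestronglyMeasurable.congr ?_
  have h : ∀ᵐ p : Vec d × ℝ ∂(volume.prod (volume.restrict (Set.Ioi (0 : ℝ)))), 0 < p.2 :=
    Measure.quasiMeasurePreserving_snd.ae (ae_restrict_mem measurableSet_Ioi)
  filter_upwards [h] with p hp
  rw [gaussKernel_smul ν L hp hL.det_pos.ne'.isUnit]

/-- By Tonelli: each Gaussian slice has mass one, so the slice norms are e^(-t), which is integrable
on (0, ∞). This licenses the exchange of integrals below. -/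
lemma integrable_gaussMixing {L : Matrix (Fin d) (Fin d) ℝ} (hL : L.PosDef) (ν : Vec d) :
    Integrable (fun p : Vec d × ℝ ↦ Real.exp (-p.2) * gaussKernel ν ((2 * p.2) • L) p.1)
      (volume.prod (volume.restrict (Set.Ioi (0 : ℝ)))) := by
  rw [integrable_prod_iff' (aestronglyMeasurable_gaussMixing hL ν)]
  constructor
  · filter_upwards [ae_restrict_mem measurableSet_Ioi] with t ht
    exact (integrable_gaussKernel (posDef_smul_of_pos hL ht) ν).const_mul _
  · refine (integrableOn_exp_neg_Ioi 0).congr ?_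
    filter_upwards [ae_restrict_mem measurableSet_Ioi] with t ht
    have : ∀ x, ‖Real.exp (-t) * gaussKernel ν ((2 * t) • L) x‖ =
        Real.exp (-t) * gaussKernel ν ((2 * t) • L) x := fun x ↦
      Real.norm_of_nonneg (mul_nonneg (Real.exp_pos _).le (gaussKernel_nonneg _ _ _))
    simp_rw [this]
    rw [integral_const_mul, integral_gaussKernel (posDef_smul_of_pos hL ht), mul_one]

/-- The condition d ≥ 1 makes the excluded point ν a null set. -/
lemma laplaceKernel_ae_eq (hd : 1 ≤ d) {L : Matrix (Fin d) (Fin d) ℝ} (hL : L.PosDef)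
    (ν : Vec d) :
    laplaceKernel ν L =ᵐ[volume] fun x ↦
      ∫ t in Set.Ioi (0 : ℝ), Real.exp (-t) * gaussKernel ν ((2 * t) • L) x := by
  have : Nonempty (Fin d) := ⟨⟨0, hd⟩⟩
  have h : ∀ᵐ x : Vec d, x ≠ ν := by
    rw [ae_iff]
    simp
  filter_upwards [h] with x hx using laplaceKernel_eq_integral hL hx

lemma integrable_laplaceKernel (hd : 1 ≤ d) {L : Matrix (Fin d) (Fin d) ℝ} (hL : L.PosDef)
    (ν : Vec d) : Integrable (laplaceKernel ν L) :=
  (integrable_gaussMixing hL ν).integral_prod_left.congr (laplaceKernel_ae_eq hd hL ν).symm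

/-- The characteristic function of a nondegenerate elliptical Laplace density. -/
theorem densityCF_laplaceKernel (hd : 1 ≤ d) {L : Matrix (Fin d) (Fin d) ℝ} (hL : L.PosDef)
    (ν η : Vec d) :
    densityCF (laplaceKernel ν L) η =
      Complex.exp (Complex.I * ((inner ℝ η ν : ℝ) : ℂ)) / (1 + ((quadForm L η : ℝ) : ℂ)) := by
  have hq : 0 ≤ quadForm L η := by
    rcases eq_or_ne η 0 with rfl | h
    · rw [quadForm_zero]
    · exact (quadForm_pos hL h).le
  have hint : Integrable (Function.uncurry fun (x : Vec d) (t : ℝ) ↦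
      Complex.exp (Complex.I * ((inner ℝ η x : ℝ) : ℂ)) *
        ((Real.exp (-t) * gaussKernel ν ((2 * t) • L) x : ℝ) : ℂ))
      (volume.prod (volume.restrict (Set.Ioi (0 : ℝ)))) :=
    (integrable_gaussMixing hL ν).ofReal.bdd_mul (c := 1) (by fun_prop)
      (ae_of_all _ fun x ↦ by rw [mul_comm, Complex.norm_exp_ofReal_mul_I])
  have e1 : densityCF (laplaceKernel ν L) η = ∫ x : Vec d, ∫ t in Set.Ioi (0 : ℝ),
      Complex.exp (Complex.I * ((inner ℝ η x : ℝ) : ℂ)) *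
        ((Real.exp (-t) * gaussKernel ν ((2 * t) • L) x : ℝ) : ℂ) := by
    refine integral_congr_ae ?_
    filter_upwards [laplaceKernel_ae_eq hd hL ν] with x hx
    rw [hx, integral_const_mul, integral_complex_ofReal]
  -- With t outermost, the inner integral is a Gaussian characteristic function, and what remains is
  -- the integral over t > 0 of exp(-(1 + ηᵀLη)t).
  rw [e1, integral_integral_swap hint]
  have e2 : ∀ t ∈ Set.Ioi (0 : ℝ), ∫ x : Vec d,
      Complex.exp (Complex.I * ((inner ℝ η x : ℝ) : ℂ)) *
        ((Real.exp (-t) * gaussKernel ν ((2 * t) • L) x : ℝ) : ℂ) =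
      Complex.exp (Complex.I * ((inner ℝ η ν : ℝ) : ℂ)) *
        Complex.exp ((-(1 + ((quadForm L η : ℝ) : ℂ))) * t) := by
    intro t ht
    have := densityCF_gaussKernel (posDef_smul_of_pos hL ht) ν η
    rw [densityCF] at this
    simp_rw [Complex.ofReal_mul, mul_left_comm _ ((Real.exp (-t) : ℝ) : ℂ)]
    rw [integral_const_mul, this, quadForm_smul_matrix, Complex.ofReal_exp, ← Complex.exp_add,
      ← Complex.exp_add]
    congr 1
    push_cast
    ring
  rw [setIntegral_congr_fun measurableSet_Ioi e2, integral_const_mul,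
    integral_exp_mul_complex_Ioi (by simp; linarith)]
  have hne : (1 + ((quadForm L η : ℝ) : ℂ)) ≠ 0 := by
    norm_cast
    positivity
  simp only [Complex.ofReal_zero, mul_zero, Complex.exp_zero]
  field_simp

end Laplace

/-! ### The mixture: its transform and the Plancherel form of the error -/

section Mixture

variable {d KG KL : ℕ}

lemma densityCF_add {f g : Vec d → ℝ} (hf : Integrable f) (hg : Integrable g) (η : Vec d) :
    densityCF (fun x ↦ f x + g x) η = densityCF f η + densityCF g η := by
  have := densityCF_sub (hf.add hg) hg η
  simp only [Pi.add_apply, add_sub_cancel_right] at this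
  rw [this, sub_add_cancel]
  rfl

lemma densityCF_const_mul (c : ℝ) (g : Vec d → ℝ) (η : Vec d) :
    densityCF (fun x ↦ c * g x) η = c * densityCF g η := by
  rw [densityCF, densityCF, ← integral_const_mul]
  congr 1
  funext x
  push_cast
  ring

lemma densityCF_sum {ι : Type*} (s : Finset ι) {f : ι → Vec d → ℝ}
    (hf : ∀ i ∈ s, Integrable (f i)) (η : Vec d) :
    densityCF (fun x ↦ ∑ i ∈ s, f i x) η = ∑ i ∈ s, densityCF (f i) η := by
  classical
  induction s using Finset.induction_on with
  | empty => simp [densityCF]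
  | insert i s hi ih =>
    simp only [Finset.sum_insert hi]
    rw [densityCF_add (hf i (by simp)) (integrable_finsetSum s fun j hj ↦ hf j (by simp [hj])),
      ih fun j hj ↦ hf j (by simp [hj])]

lemma integrable_mixtureDensity (hd : 1 ≤ d) {θ : Param d KG KL} (hG : ∀ k, (θ.covG k).PosDef)
    (hL : ∀ l, (θ.covL l).PosDef) : Integrable (mixtureDensity θ) :=
  (integrable_finsetSum _ fun k _ ↦ (integrable_gaussKernel (hG k) _).const_mul _).add
    (integrable_finsetSum _ fun l _ ↦ (integrable_laplaceKernel hd (hL l) _).const_mul _)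

theorem densityCF_mixtureDensity (hd : 1 ≤ d) {θ : Param d KG KL} (hG : ∀ k, (θ.covG k).PosDef)
    (hL : ∀ l, (θ.covL l).PosDef) (η : Vec d) :
    densityCF (mixtureDensity θ) η = mixtureCF θ η := by
  have h1 : ∀ k ∈ Finset.univ, Integrable fun x ↦
      θ.weightG k * gaussKernel (θ.locG k) (θ.covG k) x :=
    fun k _ ↦ (integrable_gaussKernel (hG k) _).const_mul _
  have h2 : ∀ l ∈ Finset.univ, Integrable fun x ↦
      θ.weightL l * laplaceKernel (θ.locL l) (θ.covL l) x :=
    fun l _ ↦ (integrable_laplaceKernel hd (hL l) _).const_mul _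
  unfold mixtureDensity mixtureCF
  rw [densityCF_add (integrable_finsetSum _ h1) (integrable_finsetSum _ h2),
    densityCF_sum _ h1, densityCF_sum _ h2]
  simp_rw [densityCF_const_mul, densityCF_gaussKernel (hG _), densityCF_laplaceKernel hd (hL _)]

theorem sqL2Dist_eq_lintegral_densityCF {f h : Vec d → ℝ} (hf : Integrable f)
    (hh : Integrable h) :
    sqL2Dist f h = ENNReal.ofReal (1 / (2 * Real.pi) ^ d) *
      ∫⁻ η, ‖densityCF f η - densityCF h η‖ₑ ^ 2 := by
  have := lintegral_enorm_sq_densityCF (hf.sub hh)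
  have e : (fun x ↦ f x - h x) = f - h := rfl
  simp_rw [← densityCF_sub hf hh, e, this]
  rw [← mul_assoc, ← ENNReal.ofReal_mul (by positivity), one_div,
    inv_mul_cancel₀ (by positivity), ENNReal.ofReal_one, one_mul, sqL2Dist]
  refine lintegral_congr fun x ↦ ?_
  rw [ENNReal.ofReal_pow (abs_nonneg _), ← Real.norm_eq_abs, ofReal_norm]
  rfl

end Mixture

/-! ### Quadratic forms under Loewner bounds -/

section LoewnerBounds

variable {d : ℕ} {S : Matrix (Fin d) (Fin d) ℝ} {a b : ℝ}

lemma quadForm_nonneg (hS : S.PosSemidef) (v : Vec d) : 0 ≤ quadForm S v := by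
  simpa [quadForm] using hS.dotProduct_mulVec_nonneg (WithLp.ofLp v)

lemma quadForm_sub_matrix (A B : Matrix (Fin d) (Fin d) ℝ) (v : Vec d) :
    quadForm (A - B) v = quadForm A v - quadForm B v := by
  simp [quadForm, Matrix.sub_mulVec]

lemma quadForm_one (v : Vec d) : quadForm 1 v = ‖v‖ ^ 2 := by
  rw [quadForm, EuclideanSpace.norm_sq_eq]
  simp [dotProduct, sq]

lemma le_quadForm (h : (S - a ^ 2 • (1 : Matrix (Fin d) (Fin d) ℝ)).PosSemidef) (v : Vec d) :
    a ^ 2 * ‖v‖ ^ 2 ≤ quadForm S v := by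
  have := quadForm_nonneg h v
  rw [quadForm_sub_matrix, quadForm_smul_matrix, quadForm_one] at this
  linarith

lemma quadForm_le (h : (b ^ 2 • (1 : Matrix (Fin d) (Fin d) ℝ) - S).PosSemidef) (v : Vec d) :
    quadForm S v ≤ b ^ 2 * ‖v‖ ^ 2 := by
  have := quadForm_nonneg h v
  rw [quadForm_sub_matrix, quadForm_smul_matrix, quadForm_one] at this
  linarith

lemma posDef_of_loewner_le (ha : 0 < a)
    (h : (S - a ^ 2 • (1 : Matrix (Fin d) (Fin d) ℝ)).PosSemidef) : S.PosDef := by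
  have h1 : (a ^ 2 • (1 : Matrix (Fin d) (Fin d) ℝ)).PosDef :=
    Matrix.PosDef.one.smul (by positivity)
  simpa using h1.posSemidef_add h

/-- Writing S = AAᵀ makes the form a squared norm ‖Aᵀv‖², and the upper Loewner bound says that Aᵀ
has operator norm at most |b|. The difference of squares then factors into a sum at most 2ρ|b| and a
difference at most |b|‖u - v‖. -/
lemma abs_quadForm_sub_le (hS : S.PosDef)
    (h : (b ^ 2 • (1 : Matrix (Fin d) (Fin d) ℝ) - S).PosSemidef) {ρ : ℝ} {u v : Vec d}
    (hu : ‖u‖ ≤ ρ) (hv : ‖v‖ ≤ ρ) :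
    |quadForm S u - quadForm S v| ≤ 2 * ρ * b ^ 2 * ‖u - v‖ := by
  obtain ⟨A, rfl, -, -⟩ := exists_eq_mul_transpose_of_posDef hS
  set T := Matrix.toEuclideanLin A.transpose
  have hT : ∀ w : Vec d, ‖T w‖ ≤ |b| * ‖w‖ := fun w ↦ by
    have := quadForm_le h w
    rw [quadForm_mul_transpose, ← sq_abs b, ← mul_pow] at this
    exact (pow_le_pow_iff_left₀ (norm_nonneg _) (by positivity) two_ne_zero).1 this
  rw [quadForm_mul_transpose, quadForm_mul_transpose, sq_sub_sq, abs_mul, abs_of_nonneg (by positivity)]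
  have h1 : |‖T u‖ - ‖T v‖| ≤ |b| * ‖u - v‖ :=
    (abs_norm_sub_norm_le _ _).trans (by rw [← map_sub]; exact hT _)
  have h2 : ‖T u‖ + ‖T v‖ ≤ |b| * (2 * ρ) := by
    have := hT u
    have := hT v
    have := mul_le_mul_of_nonneg_left hu (abs_nonneg b)
    have := mul_le_mul_of_nonneg_left hv (abs_nonneg b)
    linarith
  have h3 := mul_le_mul h2 h1 (abs_nonneg _) (le_trans (by positivity) h2)
  calc _ ≤ _ := h3
    _ = 2 * ρ * (|b| ^ 2) * ‖u - v‖ := by ring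
    _ = _ := by rw [sq_abs]

end LoewnerBounds

/-! ### Lipschitz bounds for the scalar building blocks -/

section ElementaryBounds

lemma abs_exp_neg_sub_exp_neg_le {x y : ℝ} (hx : 0 ≤ x) (hy : 0 ≤ y) :
    |Real.exp (-x) - Real.exp (-y)| ≤ |x - y| := by
  have key : ∀ {x y : ℝ}, 0 ≤ x → x ≤ y → Real.exp (-x) - Real.exp (-y) ≤ y - x := by
    intro x y hx hxy
    have h1 : Real.exp (-y) = Real.exp (-x) * Real.exp (-(y - x)) := by
      rw [← Real.exp_add]; congr 1; ring
    have h2 := Real.add_one_le_exp (-(y - x))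
    have h3 : Real.exp (-x) ≤ 1 := Real.exp_le_one_iff.2 (by linarith)
    have h4 := (Real.exp_pos (-x))
    rw [h1]
    nlinarith
  rcases le_total x y with h | h
  · rw [abs_of_nonneg (sub_nonneg.2 (Real.exp_le_exp.2 (by linarith))), abs_sub_comm,
      abs_of_nonneg (sub_nonneg.2 h)]
    exact key hx h
  · rw [abs_sub_comm, abs_of_nonneg (sub_nonneg.2 (Real.exp_le_exp.2 (by linarith))),
      abs_of_nonneg (sub_nonneg.2 h)]
    exact key hy h

lemma abs_one_div_one_add_sub_le {x y : ℝ} (hx : 0 ≤ x) (hy : 0 ≤ y) :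
    |1 / (1 + x) - 1 / (1 + y)| ≤ |x - y| := by
  have h1 : 1 / (1 + x) - 1 / (1 + y) = (y - x) / ((1 + x) * (1 + y)) := by
    field_simp
    ring
  rw [h1, abs_div, abs_of_pos (by positivity : 0 < (1 + x) * (1 + y)), abs_sub_comm y x]
  exact div_le_self (abs_nonneg _) (by nlinarith)

lemma norm_exp_I_mul_sub_le (s t : ℝ) :
    ‖Complex.exp (Complex.I * s) - Complex.exp (Complex.I * t)‖ ≤ |s - t| := by
  have h : Complex.exp (Complex.I * s) - Complex.exp (Complex.I * t) =
      Complex.exp (Complex.I * t) * (Complex.exp (Complex.I * ((s - t : ℝ) : ℂ)) - 1) := by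
    rw [mul_sub, ← Complex.exp_add]
    push_cast
    ring_nf
  rw [h, norm_mul, mul_comm Complex.I (t : ℂ), Complex.norm_exp_ofReal_mul_I, one_mul]
  exact Real.norm_exp_I_mul_ofReal_sub_one_le

lemma norm_exp_I_mul_mul_sub_le (s t : ℝ) {a b : ℝ} (ha : |a| ≤ 1) :
    ‖Complex.exp (Complex.I * s) * a - Complex.exp (Complex.I * t) * b‖ ≤ |s - t| + |a - b| := by
  have h : Complex.exp (Complex.I * s) * a - Complex.exp (Complex.I * t) * b =
      (Complex.exp (Complex.I * s) - Complex.exp (Complex.I * t)) * a +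
        Complex.exp (Complex.I * t) * ((a - b : ℝ) : ℂ) := by
    push_cast
    ring
  rw [h]
  refine (norm_add_le _ _).trans (add_le_add ?_ ?_)
  · rw [norm_mul, Complex.norm_real, Real.norm_eq_abs]
    exact (mul_le_of_le_one_right (norm_nonneg _) ha).trans (norm_exp_I_mul_sub_le s t)
  · rw [norm_mul, mul_comm Complex.I (t : ℂ), Complex.norm_exp_ofReal_mul_I, one_mul,
      Complex.norm_real, Real.norm_eq_abs]

end ElementaryBounds

/-! ### Uniform size and Lipschitz bounds for the learned characteristic function -/

section MixtureCF

variable {d KG KL : ℕ} {μbar σmin σmax bmin bmax : ℝ}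

lemma posDef_covG (hσ : 0 < σmin) {θ : Param d KG KL}
    (hθ : θ ∈ paramSet d KG KL μbar σmin σmax bmin bmax) (k : Fin KG) : (θ.covG k).PosDef :=
  posDef_of_loewner_le hσ (hθ.2.2.2.2.2.1 k)

lemma posDef_covL (hb : 0 < bmin) {θ : Param d KG KL}
    (hθ : θ ∈ paramSet d KG KL μbar σmin σmax bmin bmax) (l : Fin KL) : (θ.covL l).PosDef :=
  posDef_of_loewner_le hb (hθ.2.2.2.2.2.2.2.1 l)

/-- Each component is split into a unimodular phase and a real amplitude, the form to which the
scalar bounds apply. -/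
lemma mixtureCF_eq (θ : Param d KG KL) (η : Vec d) :
    mixtureCF θ η = ∑ k, (θ.weightG k : ℂ) *
      (Complex.exp (Complex.I * ((inner ℝ η (θ.locG k) : ℝ) : ℂ)) *
        ((Real.exp (-(quadForm (θ.covG k) η / 2)) : ℝ) : ℂ)) +
    ∑ l, (θ.weightL l : ℂ) *
      (Complex.exp (Complex.I * ((inner ℝ η (θ.locL l) : ℝ) : ℂ)) *
        ((1 / (1 + quadForm (θ.covL l) η) : ℝ) : ℂ)) := by
  unfold mixtureCF
  congr 1
  · refine Finset.sum_congr rfl fun k _ ↦ ?_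
    rw [Complex.ofReal_exp, ← Complex.exp_add]
    push_cast
    ring_nf
  · refine Finset.sum_congr rfl fun l _ ↦ ?_
    push_cast
    ring

lemma norm_sum_ofReal_mul_le {ι : Type*} [Fintype ι] {w : ι → ℝ} (hw : ∀ i, 0 ≤ w i) {A : ι → ℂ}
    {c : ℝ} (hA : ∀ i, ‖A i‖ ≤ c) : ‖∑ i, (w i : ℂ) * A i‖ ≤ (∑ i, w i) * c := by
  rw [Finset.sum_mul]
  refine norm_sum_le_of_le _ fun i _ ↦ ?_
  rw [norm_mul, Complex.norm_real, Real.norm_of_nonneg (hw i)]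
  exact mul_le_mul_of_nonneg_left (hA i) (hw i)

/-- A convex combination inherits a common bound, so no constant depends on the number of
components. -/
lemma norm_sum_add_sum_le {ι κ : Type*} [Fintype ι] [Fintype κ] {w : ι → ℝ} {v : κ → ℝ}
    (hw : ∀ i, 0 ≤ w i) (hv : ∀ i, 0 ≤ v i) (h1 : ∑ i, w i + ∑ i, v i = 1) {A : ι → ℂ} {B : κ → ℂ}
    {c : ℝ} (hA : ∀ i, ‖A i‖ ≤ c) (hB : ∀ i, ‖B i‖ ≤ c) :
    ‖∑ i, (w i : ℂ) * A i + ∑ i, (v i : ℂ) * B i‖ ≤ c :=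
  calc _ ≤ (∑ i, w i) * c + (∑ i, v i) * c := (norm_add_le _ _).trans
        (add_le_add (norm_sum_ofReal_mul_le hw hA) (norm_sum_ofReal_mul_le hv hB))
    _ = c := by rw [← add_mul, h1, one_mul]

lemma norm_exp_I_mul_mul (s : ℝ) {a : ℝ} (ha : 0 ≤ a) :
    ‖Complex.exp (Complex.I * s) * (a : ℂ)‖ = a := by
  rw [norm_mul, mul_comm Complex.I, Complex.norm_exp_ofReal_mul_I, one_mul, Complex.norm_real,
    Real.norm_of_nonneg ha]

/-- The bounds on c are functions of an index, so that a bound is demanded only for component types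
that occur; for `KL = 0` the Laplace bound is vacuous. -/
lemma norm_mixtureCF_le {θ : Param d KG KL}
    (hθ : θ ∈ paramSet d KG KL μbar σmin σmax bmin bmax) {η : Vec d} {c : ℝ}
    (hG : Fin KG → Real.exp (-(σmin ^ 2 * ‖η‖ ^ 2 / 2)) ≤ c)
    (hL : Fin KL → 1 / (1 + bmin ^ 2 * ‖η‖ ^ 2) ≤ c) : ‖mixtureCF θ η‖ ≤ c := by
  obtain ⟨h1, h2, h3, -, -, h6, -, h8, -⟩ := hθ
  rw [mixtureCF_eq]
  refine norm_sum_add_sum_le h1 h2 h3 (fun k ↦ ?_) fun l ↦ ?_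
  · rw [norm_exp_I_mul_mul _ (Real.exp_pos _).le]
    have := le_quadForm (h6 k) η
    exact (Real.exp_le_exp.2 (by linarith)).trans (hG k)
  · have := le_quadForm (h8 l) η
    have h0 : 0 ≤ bmin ^ 2 * ‖η‖ ^ 2 := by positivity
    rw [norm_exp_I_mul_mul _ (one_div_nonneg.2 (by linarith))]
    exact (one_div_le_one_div_of_le (by linarith) (by linarith)).trans (hL l)

lemma norm_mixtureCF_le_one {θ : Param d KG KL}
    (hθ : θ ∈ paramSet d KG KL μbar σmin σmax bmin bmax) (η : Vec d) : ‖mixtureCF θ η‖ ≤ 1 := by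
  refine norm_mixtureCF_le hθ (fun _ ↦ Real.exp_le_one_iff.2 ?_) (fun _ ↦ ?_)
  · have : 0 ≤ σmin ^ 2 * ‖η‖ ^ 2 := by positivity
    linarith
  · have : 0 ≤ bmin ^ 2 * ‖η‖ ^ 2 := by positivity
    rw [div_le_one (by positivity)]
    linarith

/-- The functions `mixtureCF θ`, `θ ∈ paramSet`, are Lipschitz on balls, uniformly in `θ`. -/
lemma norm_mixtureCF_sub_le (hσ : 0 < σmin) (hb : 0 < bmin) {θ : Param d KG KL}
    (hθ : θ ∈ paramSet d KG KL μbar σmin σmax bmin bmax) {ρ : ℝ} {u v : Vec d}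
    (hu : ‖u‖ ≤ ρ) (hv : ‖v‖ ≤ ρ) :
    ‖mixtureCF θ u - mixtureCF θ v‖ ≤
      (|μbar| + 2 * ρ * (σmax ^ 2 + bmax ^ 2)) * ‖u - v‖ := by
  have hPG := posDef_covG hσ hθ
  have hPL := posDef_covL hb hθ
  obtain ⟨h1, h2, h3, h4, h5, -, h7, -, h9⟩ := hθ
  have hρ : 0 ≤ ρ := (norm_nonneg u).trans hu
  have hloc : ∀ {m : Vec d}, ‖m‖ ≤ μbar →
      |(inner ℝ u m : ℝ) - (inner ℝ v m : ℝ)| ≤ |μbar| * ‖u - v‖ := by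
    intro m hm
    rw [← inner_sub_left]
    refine (abs_real_inner_le_norm _ _).trans ?_
    rw [mul_comm]
    exact mul_le_mul_of_nonneg_right (hm.trans (le_abs_self _)) (norm_nonneg _)
  rw [mixtureCF_eq, mixtureCF_eq, add_sub_add_comm, ← Finset.sum_sub_distrib,
    ← Finset.sum_sub_distrib]
  simp_rw [← mul_sub]
  have hs : 0 ≤ 2 * ρ * σmax ^ 2 * ‖u - v‖ := by positivity
  have hs' : 0 ≤ 2 * ρ * bmax ^ 2 * ‖u - v‖ := by positivity
  refine norm_sum_add_sum_le h1 h2 h3 (fun k ↦ ?_) fun l ↦ ?_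
  · have n1 := quadForm_nonneg (hPG k).posSemidef u
    have n2 := quadForm_nonneg (hPG k).posSemidef v
    refine (norm_exp_I_mul_mul_sub_le _ _ ?_).trans ?_
    · rw [abs_of_pos (Real.exp_pos _)]
      exact Real.exp_le_one_iff.2 (by linarith)
    · have e1 := abs_exp_neg_sub_exp_neg_le (div_nonneg n1 two_pos.le) (div_nonneg n2 two_pos.le)
      have e2 := abs_quadForm_sub_le (hPG k) (h7 k) hu hv
      rw [← sub_div, abs_div, abs_two] at e1
      have e3 := hloc (h4 k)
      linarith
  · have n1 := quadForm_nonneg (hPL l).posSemidef u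
    have n2 := quadForm_nonneg (hPL l).posSemidef v
    refine (norm_exp_I_mul_mul_sub_le _ _ ?_).trans ?_
    · rw [abs_of_nonneg (by positivity), div_le_one (by positivity)]
      linarith
    · have e1 := abs_one_div_one_add_sub_le n1 n2
      have e2 := abs_quadForm_sub_le (hPL l) (h9 l) hu hv
      have e3 := hloc (h5 l)
      linarith

end MixtureCF

/-! ### Uniform smallness of the tails -/

section Tails

variable {d KG KL : ℕ} {μbar σmin σmax bmin bmax : ℝ}

lemma measurableSet_cube (R : ℝ) : MeasurableSet (cube d R) := by
  unfold cube
  measurability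

/-- Continuity from above for the finite measure with density h, along the complements of cubes,
which decrease to the empty set. -/
lemma exists_setLIntegral_compl_cube_le {h : Vec d → ℝ≥0∞} (hfin : ∫⁻ η, h η ≠ ⊤) {ε : ℝ} (hε : 0 < ε) :
    ∃ η₀ : ℝ, ∀ η' : ℝ, η₀ ≤ η' → ∫⁻ η in (cube d η')ᶜ, h η ≤ ENNReal.ofReal ε := by
  set ν : Measure (Vec d) := volume.withDensity h
  have hν : IsFiniteMeasure ν := isFiniteMeasure_withDensity hfin
  have hanti : Antitone fun R : ℝ ↦ (cube d R)ᶜ := fun R R' hR ↦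
    Set.compl_subset_compl.2 fun η hη j ↦ (hη j).trans hR
  have hempty : ⋂ R : ℝ, (cube d R)ᶜ = ∅ := by
    refine Set.eq_empty_of_forall_notMem fun η hη ↦ ?_
    refine Set.mem_iInter.1 hη ‖η‖ fun j ↦ ?_
    rw [← Real.norm_eq_abs]
    exact PiLp.norm_apply_le η j
  have ht := tendsto_measure_iInter_atTop (μ := ν)
    (fun R ↦ (measurableSet_cube R).compl.nullMeasurableSet) hanti ⟨0, measure_ne_top _ _⟩
  rw [hempty, measure_empty] at ht
  have := ht.eventually (ge_mem_nhds (ENNReal.ofReal_pos.2 hε))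
  obtain ⟨R, hR⟩ := Filter.eventually_atTop.1 this
  refine ⟨R, fun η' hη' ↦ ?_⟩
  rw [← withDensity_apply _ (measurableSet_cube η').compl]
  exact hR η' hη'

/-- Almost everywhere |g|² ≤ ‖g‖_∞ |g|. -/
lemma lintegral_enorm_sq_ne_top {g : Vec d → ℝ} (hg : Integrable g) (hb : MemLp g ⊤ volume) :
    ∫⁻ x, ‖g x‖ₑ ^ 2 ≠ ⊤ := by
  have h1 : ∫⁻ x, ‖g x‖ₑ ^ 2 ≤ ∫⁻ x, eLpNorm g ⊤ volume * ‖g x‖ₑ := by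
    refine lintegral_mono_ae ?_
    filter_upwards [ae_le_eLpNormEssSup (f := g) (μ := volume)] with x hx
    rw [sq, eLpNorm_exponent_top]
    gcongr
  rw [lintegral_const_mul'' _ hg.aestronglyMeasurable.enorm] at h1
  exact ne_top_of_le_ne_top (ENNReal.mul_ne_top hb.2.ne hg.2.ne) h1

lemma lintegral_ofReal_ne_top_of_le {f h : Vec d → ℝ} (hh : Integrable h) (hle : ∀ x, f x ≤ h x) :
    ∫⁻ x, ENNReal.ofReal (f x) ≠ ⊤ := by
  refine ne_top_of_le_ne_top hh.2.ne (lintegral_mono fun x ↦ ?_)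
  rw [← ofReal_norm]
  exact ENNReal.ofReal_le_ofReal ((hle x).trans (le_abs_self _))

lemma enorm_sq_le_ofReal {z : ℂ} {c : ℝ} (h : ‖z‖ ≤ c) : ‖z‖ₑ ^ 2 ≤ ENNReal.ofReal (c ^ 2) := by
  rw [← ofReal_norm, ← ENNReal.ofReal_pow (norm_nonneg _)]
  exact ENNReal.ofReal_le_ofReal (pow_le_pow_left₀ (norm_nonneg _) h 2)

/-- A majorant independent of θ makes the cutoff radius uniform. Laplace components decay only like
‖η‖⁻², and the square of this is integrable at infinity precisely for d < 4; Gaussian components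
alone cause no restriction on d. -/
lemma exists_dominating_mixtureCF (hσ : 0 < σmin) (hb : 0 < bmin) (hd : d ≤ 3 ∨ KL = 0) :
    ∃ h : Vec d → ℝ≥0∞, ∫⁻ η, h η ≠ ⊤ ∧
      ∀ θ ∈ paramSet d KG KL μbar σmin σmax bmin bmax, ∀ η, ‖mixtureCF θ η‖ₑ ^ 2 ≤ h η := by
  rcases hd with hd | rfl
  -- This c gives c(1 + ‖η‖²) ≤ 1 + σmin²‖η‖²/2 ≤ exp(σmin²‖η‖²/2) and c(1 + ‖η‖²) ≤ 1 + bmin²‖η‖²,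
  -- so both kinds of components lie below the same function.
  · set c := min 1 (min (σmin ^ 2 / 2) (bmin ^ 2)) with hc
    have hc0 : 0 < c := by positivity
    have hc1 : c ≤ 1 := min_le_left _ _
    have hc2 : c ≤ σmin ^ 2 / 2 := (min_le_right _ _).trans (min_le_left _ _)
    have hc3 : c ≤ bmin ^ 2 := (min_le_right _ _).trans (min_le_right _ _)
    refine ⟨fun η ↦ ENNReal.ofReal ((c⁻¹ * (1 + ‖η‖ ^ 2)⁻¹) ^ 2), ?_, fun θ hθ η ↦
      enorm_sq_le_ofReal (norm_mixtureCF_le hθ (fun _ ↦ ?_) fun _ ↦ ?_)⟩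
    · have hi : Integrable fun η : Vec d ↦ (1 + ‖η‖ ^ 2) ^ (-(4 : ℝ) / 2) :=
        integrable_rpow_neg_one_add_norm_sq (by
          rw [finrank_euclideanSpace_fin]
          have : (d : ℝ) ≤ 3 := by exact_mod_cast hd
          linarith)
      refine lintegral_ofReal_ne_top_of_le (hi.const_mul (c⁻¹ ^ 2)) fun η ↦ le_of_eq ?_
      have : (-(4 : ℝ) / 2) = -((2 : ℕ) : ℝ) := by norm_num
      rw [this, Real.rpow_neg (by positivity), Real.rpow_natCast, mul_pow, inv_pow (1 + _)]
    · rw [← mul_inv, Real.exp_neg]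
      have h1 := Real.add_one_le_exp (σmin ^ 2 * ‖η‖ ^ 2 / 2)
      have h2 := mul_le_mul_of_nonneg_right hc2 (sq_nonneg ‖η‖)
      exact inv_anti₀ (by positivity) (by linarith)
    · rw [← mul_inv, one_div]
      have h2 := mul_le_mul_of_nonneg_right hc3 (sq_nonneg ‖η‖)
      exact inv_anti₀ (by positivity) (by linarith)
  · refine ⟨fun η ↦ ENNReal.ofReal (Real.exp (-(σmin ^ 2 * ‖η‖ ^ 2 / 2)) ^ 2), ?_,
      fun θ hθ η ↦ enorm_sq_le_ofReal (norm_mixtureCF_le hθ (fun _ ↦ le_rfl) fun l ↦ l.elim0)⟩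
    have := (GaussianFourier.integrable_cexp_neg_mul_sq_norm_add (b := ((σmin ^ 2 : ℝ) : ℂ))
      (V := Vec d) (by rw [Complex.ofReal_re]; positivity) 0 0).norm
    refine lintegral_ofReal_ne_top_of_le this fun η ↦ le_of_eq ?_
    rw [Complex.norm_exp, ← Real.exp_nat_mul]
    congr 1
    simp [← Complex.ofReal_pow]
    ring

theorem exists_tailMass_le (hσ : 0 < σmin) (hb : 0 < bmin) {g : Vec d → ℝ} (hg : Integrable g)
    (hg_bdd : MemLp g ⊤ volume) (hd : d ≤ 3 ∨ KL = 0) {ε : ℝ} (hε : 0 < ε) :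
    ∃ η₀ : ℝ, 0 < η₀ ∧ ∀ η' : ℝ, η₀ ≤ η' →
      tailMass (densityCF g) η' ≤ ENNReal.ofReal ε ∧
      ∀ θ ∈ paramSet d KG KL μbar σmin σmax bmin bmax,
        tailMass (mixtureCF θ) η' ≤ ENNReal.ofReal ε := by
  obtain ⟨h, hfin, hle⟩ := exists_dominating_mixtureCF (KG := KG) (μbar := μbar) (σmax := σmax)
    (bmax := bmax) hσ hb hd
  have hfin' : ∫⁻ η, ‖densityCF g η‖ₑ ^ 2 ≠ ⊤ := by
    rw [lintegral_enorm_sq_densityCF hg]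
    exact ENNReal.mul_ne_top ENNReal.ofReal_ne_top (lintegral_enorm_sq_ne_top hg hg_bdd)
  obtain ⟨R₁, h₁⟩ := exists_setLIntegral_compl_cube_le hfin hε
  obtain ⟨R₂, h₂⟩ := exists_setLIntegral_compl_cube_le hfin' hε
  refine ⟨max 1 (max R₁ R₂), by positivity, fun η' hη' ↦ ?_⟩
  rw [max_le_iff, max_le_iff] at hη'
  exact ⟨h₂ η' hη'.2.2, fun θ hθ ↦ (lintegral_mono (hle θ hθ)).trans (h₁ η' hη'.2.1)⟩

end Tails

/-! ### Tensor grids and the Riemann sum bound -/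

section Grid

variable {d n : ℕ} {R : ℝ}

lemma exists_mem_Icc_of_strictMono {f : Fin (n + 1) → ℝ} (hf : StrictMono f) (hn : 0 < n) {t : ℝ}
    (h0 : f 0 ≤ t) (h1 : t ≤ f (Fin.last n)) :
    ∃ i : Fin n, t ∈ Set.Icc (f i.castSucc) (f i.succ) := by
  have key : ∀ k : Fin (n + 1), t ≤ f k →
      t ≤ f 0 ∨ ∃ i : Fin n, t ∈ Set.Icc (f i.castSucc) (f i.succ) := by
    intro k
    induction k using Fin.induction with
    | zero => exact fun h ↦ .inl h
    | succ k ih =>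
      intro hk
      by_cases h : t ≤ f k.castSucc
      · exact ih h
      · exact .inr ⟨k, (not_le.1 h).le, hk⟩
  rcases key _ h1 with h | h
  · exact ⟨⟨0, hn⟩, h0, h.trans (hf.monotone (Fin.zero_le _))⟩
  · exact h

namespace TensorGrid

lemma pos_of_pos (Γ : TensorGrid d n R) (hd : 1 ≤ d) (hR : 0 < R) : 0 < n := by
  rcases Nat.eq_zero_or_pos n with rfl | h
  · have h0 := Γ.pt_zero ⟨0, hd⟩
    have h1 := Γ.pt_last ⟨0, hd⟩
    have : (Fin.last 0) = 0 := rfl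
    rw [this, h0] at h1
    linarith
  · exact h

lemma width_le_maxWidth (Γ : TensorGrid d n R) (j : Fin d) (i : Fin n) :
    Γ.pt j i.succ - Γ.pt j i.castSucc ≤ Γ.maxWidth :=
  le_ciSup (f := fun q : Fin d × Fin n ↦ Γ.pt q.1 q.2.succ - Γ.pt q.1 q.2.castSucc)
    (Set.finite_range _).bddAbove (j, i)

lemma maxWidth_pos (Γ : TensorGrid d n R) (hd : 1 ≤ d) (hR : 0 < R) : 0 < Γ.maxWidth :=
  (sub_pos.2 (Γ.pt_strictMono ⟨0, hd⟩ Fin.castSucc_lt_succ)).trans_le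
    (Γ.width_le_maxWidth ⟨0, hd⟩ ⟨0, Γ.pos_of_pos hd hR⟩)

/-- The cell of the grid that belongs to the multi-index `p`. -/
def cell (Γ : TensorGrid d n R) (p : Fin d → Fin n) : Set (Vec d) :=
  {η | ∀ j, η j ∈ Set.Icc (Γ.pt j (p j).castSucc) (Γ.pt j (p j).succ)}

lemma cube_subset_iUnion_cell (Γ : TensorGrid d n R) (hn : 0 < n) :
    cube d R ⊆ ⋃ p, Γ.cell p := by
  intro η hη
  have : ∀ j, ∃ i : Fin n, η j ∈ Set.Icc (Γ.pt j i.castSucc) (Γ.pt j i.succ) := fun j ↦ by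
    have hj := abs_le.1 (hη j)
    exact exists_mem_Icc_of_strictMono (Γ.pt_strictMono j) hn (by rw [Γ.pt_zero]; exact hj.1)
      (by rw [Γ.pt_last]; exact hj.2)
  choose p hp using this
  exact Set.mem_iUnion.2 ⟨p, hp⟩

lemma cell_subset_cube (Γ : TensorGrid d n R) (p : Fin d → Fin n) : Γ.cell p ⊆ cube d R := by
  intro η hη j
  have h1 := (Γ.pt_strictMono j).monotone (Fin.zero_le (p j).castSucc)
  have h2 := (Γ.pt_strictMono j).monotone (Fin.le_last (p j).succ)
  rw [Γ.pt_zero] at h1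
  rw [Γ.pt_last] at h2
  exact abs_le.2 ⟨h1.trans (hη j).1, (hη j).2.trans h2⟩

lemma nodeVec_mem_cell (Γ : TensorGrid d n R) (p : Fin d → Fin n) : Γ.nodeVec p ∈ Γ.cell p :=
  fun j ↦ Γ.node_mem j (p j)

lemma measurableSet_cell (Γ : TensorGrid d n R) (p : Fin d → Fin n) :
    MeasurableSet (Γ.cell p) := by
  unfold cell
  measurability

lemma volume_cell_le (Γ : TensorGrid d n R) (p : Fin d → Fin n) :
    volume (Γ.cell p) ≤ ENNReal.ofReal Γ.maxWidth ^ d := by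
  have h : Γ.cell p = WithLp.ofLp ⁻¹'
      Set.Icc (fun j ↦ Γ.pt j (p j).castSucc) (fun j ↦ Γ.pt j (p j).succ) := by
    ext η
    simp [cell, Set.mem_Icc, Pi.le_def, forall_and]
  rw [h, (PiLp.volume_preserving_ofLp (Fin d)).measure_preimage measurableSet_Icc.nullMeasurableSet,
    Real.volume_Icc_pi]
  refine (Finset.prod_le_prod' fun j _ ↦
    ENNReal.ofReal_le_ofReal (Γ.width_le_maxWidth j (p j))).trans ?_
  simp

lemma norm_sub_le_of_mem_cell (Γ : TensorGrid d n R) (p : Fin d → Fin n) {u v : Vec d}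
    (hu : u ∈ Γ.cell p) (hv : v ∈ Γ.cell p) : ‖u - v‖ ≤ √d * Γ.maxWidth := by
  have h : ∀ j, (u j - v j) ^ 2 ≤ Γ.maxWidth ^ 2 := fun j ↦ by
    have hw := Γ.width_le_maxWidth j (p j)
    have h1 := hu j
    have h2 := hv j
    exact sq_le_sq' (by linarith [h1.1, h2.2]) (by linarith [h1.2, h2.1])
  rcases Nat.eq_zero_or_pos d with rfl | hd
  · simp [Subsingleton.elim u v]
  have hw : 0 ≤ Γ.maxWidth :=
    (sub_nonneg.2 ((hu ⟨0, hd⟩).1.trans (hu ⟨0, hd⟩).2)).trans (Γ.width_le_maxWidth _ _)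
  rw [EuclideanSpace.norm_eq, ← Real.sqrt_sq hw, ← Real.sqrt_mul (Nat.cast_nonneg d)]
  refine Real.sqrt_le_sqrt ?_
  calc ∑ j, ‖(u - v) j‖ ^ 2 ≤ ∑ _j : Fin d, Γ.maxWidth ^ 2 :=
        Finset.sum_le_sum fun j _ ↦ by simpa using h j
    _ = d * Γ.maxWidth ^ 2 := by simp

lemma sum_nodeVec (Γ : TensorGrid d n R) (hn : 0 < n) (f : Vec d → ℝ) :
    ∑ p, f (Γ.nodeVec p) = (n : ℝ) ^ d * Γ.mean f := by
  have : (n : ℝ) ^ d ≠ 0 := by positivity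
  rw [mean, Nat.cast_pow, ← mul_assoc, mul_one_div_cancel this, one_mul]

lemma mean_mono (Γ : TensorGrid d n R) {f h : Vec d → ℝ} (H : ∀ p, f (Γ.nodeVec p) ≤ h (Γ.nodeVec p)) :
    Γ.mean f ≤ Γ.mean h :=
  mul_le_mul_of_nonneg_left (Finset.sum_le_sum fun p _ ↦ H p) (by positivity)

lemma mean_add (Γ : TensorGrid d n R) (f h : Vec d → ℝ) :
    Γ.mean (fun η ↦ f η + h η) = Γ.mean f + Γ.mean h := by
  simp [mean, Finset.sum_add_distrib, mul_add]

lemma mean_const_mul (Γ : TensorGrid d n R) (c : ℝ) (f : Vec d → ℝ) :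
    Γ.mean (fun η ↦ c * f η) = c * Γ.mean f := by
  simp only [mean, ← Finset.mul_sum]
  ring

lemma mean_const (Γ : TensorGrid d n R) (hn : 0 < n) (c : ℝ) : Γ.mean (fun _ ↦ c) = c := by
  have : (n : ℝ) ^ d ≠ 0 := by positivity
  simp [mean, this]

lemma mean_nonneg (Γ : TensorGrid d n R) {f : Vec d → ℝ} (H : ∀ η, 0 ≤ f η) : 0 ≤ Γ.mean f :=
  mul_nonneg (by positivity) (Finset.sum_nonneg fun p _ ↦ H _)

/-- A Riemann sum bound for the squared `L²` norm of a Lipschitz function on the cube. -/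
theorem setLIntegral_cube_le (Γ : TensorGrid d n R) (hn : 0 < n) {H : Vec d → ℂ}
    {A : ℝ} (hA : 0 ≤ A) (hw : 0 ≤ Γ.maxWidth) (hbd : ∀ η, ‖H η‖ ≤ 2)
    (hlip : ∀ u ∈ cube d R, ∀ v ∈ cube d R, ‖H u - H v‖ ≤ A * ‖u - v‖) :
    ∫⁻ η in cube d R, ‖H η‖ₑ ^ 2 ≤ ENNReal.ofReal ((n * Γ.maxWidth) ^ d *
      (Γ.mean (fun η ↦ ‖H η‖ ^ 2) + 4 * A * √d * Γ.maxWidth)) := by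
  set δ := Γ.maxWidth
  have hcell : ∀ p, ∀ η ∈ Γ.cell p,
      ‖H η‖ₑ ^ 2 ≤ ENNReal.ofReal (‖H (Γ.nodeVec p)‖ ^ 2 + 4 * A * √d * δ) := by
    intro p η hη
    have h1 := hlip η (Γ.cell_subset_cube p hη) _ (Γ.cell_subset_cube p (Γ.nodeVec_mem_cell p))
    have h2 := Γ.norm_sub_le_of_mem_cell p hη (Γ.nodeVec_mem_cell p)
    have h3 := mul_le_mul_of_nonneg_left h2 hA
    have h4 := norm_sub_norm_le (H η) (H (Γ.nodeVec p))
    have h5 := hbd η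
    have h6 := hbd (Γ.nodeVec p)
    rw [← ofReal_norm, ← ENNReal.ofReal_pow (norm_nonneg _)]
    refine ENNReal.ofReal_le_ofReal ?_
    have h7 : ‖H η‖ - ‖H (Γ.nodeVec p)‖ ≤ A * (√d * δ) := h4.trans (h1.trans h3)
    -- The difference of squares is a difference at most A√d δ, by the cell diameter, times a sum at
    -- most 2 + 2.
    have h8 : 0 ≤ A * (√d * δ) := by positivity
    have h9 : (‖H η‖ - ‖H (Γ.nodeVec p)‖) * (‖H η‖ + ‖H (Γ.nodeVec p)‖) ≤ A * (√d * δ) * 4 :=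
      mul_le_mul h7 (by linarith) (by positivity) h8
    linarith
  -- The closed cells overlap on their faces, but countable subadditivity suffices for an upper
  -- bound. Replacing each cell volume by δ^d lets unequal cells be summed with equal weights.
  calc ∫⁻ η in cube d R, ‖H η‖ₑ ^ 2
      ≤ ∫⁻ η in ⋃ p, Γ.cell p, ‖H η‖ₑ ^ 2 :=
        lintegral_mono_set (Γ.cube_subset_iUnion_cell hn)
    _ ≤ ∑' p, ∫⁻ η in Γ.cell p, ‖H η‖ₑ ^ 2 := lintegral_iUnion_le _ _
    _ = ∑ p, ∫⁻ η in Γ.cell p, ‖H η‖ₑ ^ 2 := tsum_fintype _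
    _ ≤ ∑ p, ENNReal.ofReal (δ ^ d * (‖H (Γ.nodeVec p)‖ ^ 2 + 4 * A * √d * δ)) := by
        refine Finset.sum_le_sum fun p _ ↦ ?_
        refine (setLIntegral_mono' (Γ.measurableSet_cell p) (hcell p)).trans ?_
        rw [setLIntegral_const, mul_comm, ENNReal.ofReal_mul (by positivity),
          ENNReal.ofReal_pow hw]
        exact mul_le_mul_left (Γ.volume_cell_le p) _
    _ = ENNReal.ofReal (∑ p, δ ^ d * (‖H (Γ.nodeVec p)‖ ^ 2 + 4 * A * √d * δ)) :=
        (ENNReal.ofReal_sum_of_nonneg fun p _ ↦ by positivity).symm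
    _ = _ := by
        rw [Γ.sum_nodeVec hn (fun η ↦ δ ^ d * (‖H η‖ ^ 2 + 4 * A * √d * δ)), mean_const_mul,
          mean_add, mean_const _ hn, mul_pow]
        ring_nf

end TensorGrid

end Grid

/-! ### Mean squared error of the empirical characteristic function -/

section Sampling

variable {d : ℕ} {g : Vec d → ℝ}

lemma norm_exp_I_mul_le (s : ℝ) : ‖Complex.exp (Complex.I * s)‖ ≤ 1 := by
  rw [mul_comm, Complex.norm_exp_ofReal_mul_I]

lemma norm_densityCF_le_one (hg0 : ∀ᵐ x, 0 ≤ g x) (hg1 : ∫ x, g x = 1) (η : Vec d) :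
    ‖densityCF g η‖ ≤ 1 := by
  refine (norm_integral_le_integral_norm _).trans (le_of_eq ?_)
  rw [← hg1]
  refine integral_congr_ae ?_
  filter_upwards [hg0] with x hx
  rw [norm_exp_I_mul_mul _ hx]

lemma norm_empiricalCF_le_one {M : ℕ} (x : Fin M → Vec d) (η : Vec d) :
    ‖empiricalCF x η‖ ≤ 1 := by
  rw [empiricalCF, norm_mul, norm_div, norm_one, Complex.norm_natCast]
  have h : ‖∑ m, Complex.exp (Complex.I * ((inner ℝ η (x m) : ℝ) : ℂ))‖ ≤ M := by
    refine (norm_sum_le_of_le _ fun m _ ↦ norm_exp_I_mul_le _).trans ?_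
    simp
  rcases Nat.eq_zero_or_pos M with rfl | hM
  · simp
  · rw [one_div, inv_mul_le_iff₀ (by positivity), mul_one]
    exact h

variable {Ω : Type*} [MeasurableSpace Ω] {Pr : Measure Ω}

lemma integral_exp_I_inner (hg0 : ∀ᵐ x, 0 ≤ g x) (hg : Integrable g) {Y : Ω → Vec d}
    (hY : AEMeasurable Y Pr)
    (hlaw : Pr.map Y = volume.withDensity (fun x ↦ ENNReal.ofReal (g x))) (η : Vec d) :
    ∫ ω, Complex.exp (Complex.I * ((inner ℝ η (Y ω) : ℝ) : ℂ)) ∂Pr = densityCF g η := by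
  rw [← integral_map (f := fun x : Vec d ↦ Complex.exp (Complex.I * ((inner ℝ η x : ℝ) : ℂ))) hY
    (by fun_prop), hlaw,
    integral_withDensity_eq_integral_toReal_smul₀ hg.aestronglyMeasurable.aemeasurable.ennreal_ofReal
      (ae_of_all _ fun _ ↦ ENNReal.ofReal_lt_top), densityCF]
  refine integral_congr_ae ?_
  filter_upwards [hg0] with x hx
  rw [ENNReal.toReal_ofReal hx, Complex.real_smul, mul_comm]

/-- The variance of a sample mean of bounded independent variables. -/
lemma variance_sampleMean {M : ℕ} (hM : 0 < M) {Y : Fin M → Ω → ℝ} {v : ℝ}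
    (hY : ∀ m, MemLp (Y m) 2 Pr) (hind : Pairwise fun i j ↦ IndepFun (Y i) (Y j) Pr)
    (hv : ∀ m, variance (Y m) Pr = v) :
    variance (fun ω ↦ (1 / (M : ℝ)) * ∑ m, Y m ω) Pr = v / M := by
  have := IndepFun.variance_sum (s := Finset.univ) (fun i _ ↦ hY i) fun i _ j _ hij ↦ hind hij
  have e : (∑ m, Y m) = fun ω ↦ ∑ m, Y m ω := by
    ext ω; simp
  rw [variance_const_mul, ← e, this]
  simp only [hv, Finset.sum_const, Finset.card_univ, Fintype.card_fin, nsmul_eq_mul]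
  field_simp

lemma aemeasurable_empiricalCF {M : ℕ} {X : Fin M → Ω → Vec d} (hX : ∀ m, AEMeasurable (X m) Pr)
    (η : Vec d) : AEMeasurable (fun ω ↦ empiricalCF (fun m ↦ X m ω) η) Pr := by
  unfold empiricalCF
  fun_prop

/-- The mean squared error of the empirical characteristic function. -/
theorem integral_norm_densityCF_sub_empiricalCF_sq [IsProbabilityMeasure Pr]
    (hg0 : ∀ᵐ x, 0 ≤ g x) (hg : Integrable g)
    {M : ℕ} (hM : 0 < M) {X : Fin M → Ω → Vec d} (hX : ∀ m, AEMeasurable (X m) Pr)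
    (hind : iIndepFun X Pr)
    (hlaw : ∀ m, Pr.map (X m) = volume.withDensity (fun x ↦ ENNReal.ofReal (g x))) (η : Vec d) :
    ∫ ω, ‖densityCF g η - empiricalCF (fun m ↦ X m ω) η‖ ^ 2 ∂Pr =
      (1 - ‖densityCF g η‖ ^ 2) / M := by
  set G := densityCF g η with hG
  set Y : Fin M → Ω → ℂ := fun m ω ↦ Complex.exp (Complex.I * ((inner ℝ η (X m ω) : ℝ) : ℂ))
    with hYdef
  have hYm : ∀ m, AEMeasurable (Y m) Pr := fun m ↦ by
    have := hX m
    fun_prop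
  have hYn : ∀ m ω, ‖Y m ω‖ = 1 := fun m ω ↦ by
    rw [hYdef]
    simp only
    rw [mul_comm, Complex.norm_exp_ofReal_mul_I]
  have hYi : ∀ m, Integrable (Y m) Pr := fun m ↦
    .of_bound (hYm m).aestronglyMeasurable 1 (ae_of_all _ fun ω ↦ (hYn m ω).le)
  have hYG : ∀ m, ∫ ω, Y m ω ∂Pr = G := fun m ↦ integral_exp_I_inner hg0 hg (hX m) (hlaw m) η
  have hre : ∀ m, ∫ ω, (Y m ω).re ∂Pr = G.re := fun m ↦ by
    rw [← hYG m]; exact integral_re (hYi m)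
  have him : ∀ m, ∫ ω, (Y m ω).im ∂Pr = G.im := fun m ↦ by
    rw [← hYG m]; exact integral_im (hYi m)
  have hReM : ∀ m, MemLp (fun ω ↦ (Y m ω).re) 2 Pr := fun m ↦
    .of_bound (Complex.measurable_re.comp_aemeasurable (hYm m)).aestronglyMeasurable 1
      (ae_of_all _ fun ω ↦ (Complex.abs_re_le_norm _).trans (hYn m ω).le)
  have hImM : ∀ m, MemLp (fun ω ↦ (Y m ω).im) 2 Pr := fun m ↦
    .of_bound (Complex.measurable_im.comp_aemeasurable (hYm m)).aestronglyMeasurable 1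
      (ae_of_all _ fun ω ↦ (Complex.abs_im_le_norm _).trans (hYn m ω).le)
  -- The second moments a and b of the real and imaginary parts are taken under the common law, so
  -- they do not depend on m. Since |Y| = 1, they add up to 1, and the two variances add up to 1 -
  -- |G|².
  set a := ∫ x, (Complex.exp (Complex.I * ((inner ℝ η x : ℝ) : ℂ))).re ^ 2
    ∂(volume.withDensity fun x : Vec d ↦ ENNReal.ofReal (g x)) with ha
  set b := ∫ x, (Complex.exp (Complex.I * ((inner ℝ η x : ℝ) : ℂ))).im ^ 2
    ∂(volume.withDensity fun x : Vec d ↦ ENNReal.ofReal (g x)) with hb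
  have hre2 : ∀ m, ∫ ω, (Y m ω).re ^ 2 ∂Pr = a := fun m ↦ by
    rw [ha, ← hlaw m, integral_map (hX m) (Measurable.aestronglyMeasurable (by fun_prop))]
  have him2 : ∀ m, ∫ ω, (Y m ω).im ^ 2 ∂Pr = b := fun m ↦ by
    rw [hb, ← hlaw m, integral_map (hX m) (Measurable.aestronglyMeasurable (by fun_prop))]
  have hab : a + b = 1 := by
    rw [← hre2 ⟨0, hM⟩, ← him2 ⟨0, hM⟩,
      ← integral_add (hReM _).integrable_sq (hImM _).integrable_sq]
    have : ∀ ω, (Y ⟨0, hM⟩ ω).re ^ 2 + (Y ⟨0, hM⟩ ω).im ^ 2 = 1 := fun ω ↦ by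
      have := Complex.sq_norm_sub_sq_re (Y ⟨0, hM⟩ ω)
      rw [hYn] at this
      linarith
    simp [this]
  have hvre : ∀ m, variance (fun ω ↦ (Y m ω).re) Pr = a - G.re ^ 2 := fun m ↦ by
    rw [variance_eq_sub (hReM m), ← hre m, ← hre2 m]; rfl
  have hvim : ∀ m, variance (fun ω ↦ (Y m ω).im) Pr = b - G.im ^ 2 := fun m ↦ by
    rw [variance_eq_sub (hImM m), ← him m, ← him2 m]; rfl
  have hindR : Pairwise fun i j ↦ IndepFun (fun ω ↦ (Y i ω).re) (fun ω ↦ (Y j ω).re) Pr := by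
    intro i j hij
    exact (hind.indepFun hij).comp
      (φ := fun x ↦ (Complex.exp (Complex.I * ((inner ℝ η x : ℝ) : ℂ))).re)
      (ψ := fun x ↦ (Complex.exp (Complex.I * ((inner ℝ η x : ℝ) : ℂ))).re)
      (by fun_prop) (by fun_prop)
  have hindI : Pairwise fun i j ↦ IndepFun (fun ω ↦ (Y i ω).im) (fun ω ↦ (Y j ω).im) Pr := by
    intro i j hij
    exact (hind.indepFun hij).comp
      (φ := fun x ↦ (Complex.exp (Complex.I * ((inner ℝ η x : ℝ) : ℂ))).im)
      (ψ := fun x ↦ (Complex.exp (Complex.I * ((inner ℝ η x : ℝ) : ℂ))).im)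
      (by fun_prop) (by fun_prop)
  have hVR := variance_sampleMean hM hReM hindR hvre
  have hVI := variance_sampleMean hM hImM hindI hvim
  have hM0 : (M : ℝ) ≠ 0 := by positivity
  have hmR : ∫ ω, (1 / (M : ℝ)) * ∑ m, (Y m ω).re ∂Pr = G.re := by
    rw [integral_const_mul, integral_finsetSum _ fun m _ ↦ (hReM m).integrable one_le_two]
    simp [hre, hM0]
  have hmI : ∫ ω, (1 / (M : ℝ)) * ∑ m, (Y m ω).im ∂Pr = G.im := by
    rw [integral_const_mul, integral_finsetSum _ fun m _ ↦ (hImM m).integrable one_le_two]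
    simp [him, hM0]
  have hLR : MemLp (fun ω ↦ (1 / (M : ℝ)) * ∑ m, (Y m ω).re) 2 Pr :=
    (memLp_finsetSum _ fun m _ ↦ hReM m).const_mul _
  have hLI : MemLp (fun ω ↦ (1 / (M : ℝ)) * ∑ m, (Y m ω).im) 2 Pr :=
    (memLp_finsetSum _ fun m _ ↦ hImM m).const_mul _
  rw [variance_eq_integral hLR.aestronglyMeasurable.aemeasurable, hmR] at hVR
  rw [variance_eq_integral hLI.aestronglyMeasurable.aemeasurable, hmI] at hVI
  have hsplit : ∀ ω, ‖G - empiricalCF (fun m ↦ X m ω) η‖ ^ 2 =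
      ((1 / (M : ℝ)) * ∑ m, (Y m ω).re - G.re) ^ 2 +
        ((1 / (M : ℝ)) * ∑ m, (Y m ω).im - G.im) ^ 2 := by
    intro ω
    have e : empiricalCF (fun m ↦ X m ω) η = ((1 / (M : ℝ) : ℝ) : ℂ) * ∑ m, Y m ω := by
      rw [empiricalCF]
      push_cast
      rfl
    rw [e, Complex.sq_norm, Complex.normSq_apply, Complex.sub_re, Complex.sub_im,
      Complex.re_ofReal_mul, Complex.im_ofReal_mul, Complex.re_sum, Complex.im_sum]
    ring
  simp_rw [hsplit]
  have hIR : Integrable (fun ω ↦ ((1 / (M : ℝ)) * ∑ m, (Y m ω).re - G.re) ^ 2) Pr :=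
    (hLR.sub (memLp_const _)).integrable_sq
  have hII : Integrable (fun ω ↦ ((1 / (M : ℝ)) * ∑ m, (Y m ω).im - G.im) ^ 2) Pr :=
    (hLI.sub (memLp_const _)).integrable_sq
  rw [integral_add hIR hII, hVR, hVI, ← add_div]
  congr 1
  rw [Complex.sq_norm, Complex.normSq_apply]
  linear_combination hab

end Sampling

/-! ### Assembling the error bound -/

section ErrorBound

variable {d n M KG KL : ℕ} {R μbar σmin σmax bmin bmax : ℝ} {g : Vec d → ℝ}

lemma norm_le_of_mem_cube {u : Vec d} (hR : 0 ≤ R) (hu : u ∈ cube d R) : ‖u‖ ≤ √d * R := by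
  rw [EuclideanSpace.norm_eq, ← Real.sqrt_sq hR, ← Real.sqrt_mul (Nat.cast_nonneg d)]
  refine Real.sqrt_le_sqrt ?_
  calc ∑ j, ‖u j‖ ^ 2 ≤ ∑ _j : Fin d, R ^ 2 :=
        Finset.sum_le_sum fun j _ ↦ pow_le_pow_left₀ (norm_nonneg _) (hu j) 2
    _ = d * R ^ 2 := by simp

lemma norm_sub_sq_le {E : Type*} [SeminormedAddCommGroup E] (a b : E) :
    ‖a - b‖ ^ 2 ≤ 2 * ‖a‖ ^ 2 + 2 * ‖b‖ ^ 2 := by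
  have h := pow_le_pow_left₀ (norm_nonneg _) (norm_sub_le a b) 2
  nlinarith [sq_nonneg (‖a‖ - ‖b‖)]

lemma enorm_sub_sq_le (a b : ℂ) : ‖a - b‖ₑ ^ 2 ≤ 2 * ‖a‖ₑ ^ 2 + 2 * ‖b‖ₑ ^ 2 := by
  simp only [← ofReal_norm, ← ENNReal.ofReal_pow (norm_nonneg _)]
  have h2 : (2 : ℝ≥0∞) = ENNReal.ofReal 2 := by simp
  rw [h2, ← ENNReal.ofReal_mul two_pos.le, ← ENNReal.ofReal_mul two_pos.le,
    ← ENNReal.ofReal_add (by positivity) (by positivity)]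
  exact ENNReal.ofReal_le_ofReal (norm_sub_sq_le a b)

lemma tailMass_sub_le {F H : Vec d → ℂ} (hF : Continuous F) {ε : ℝ}
    (h1 : tailMass F R ≤ ENNReal.ofReal ε) (h2 : tailMass H R ≤ ENNReal.ofReal ε) :
    tailMass (fun η ↦ F η - H η) R ≤ ENNReal.ofReal (4 * ε) := by
  have hm : Measurable fun η ↦ 2 * ‖F η‖ₑ ^ 2 := (hF.measurable.enorm.pow_const 2).const_mul 2
  calc tailMass (fun η ↦ F η - H η) R
      ≤ ∫⁻ η in (cube d R)ᶜ, (2 * ‖F η‖ₑ ^ 2 + 2 * ‖H η‖ₑ ^ 2) :=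
        lintegral_mono fun η ↦ enorm_sub_sq_le _ _
    _ = 2 * tailMass F R + 2 * tailMass H R := by
        rw [lintegral_add_left hm, lintegral_const_mul' _ _ ENNReal.ofNat_ne_top,
          lintegral_const_mul' _ _ ENNReal.ofNat_ne_top]
        rfl
    _ ≤ 2 * ENNReal.ofReal ε + 2 * ENNReal.ofReal ε := by gcongr
    _ = ENNReal.ofReal (4 * ε) := by
        have h4 : (4 : ℝ≥0∞) = ENNReal.ofReal 4 := by simp
        rw [← add_mul, ENNReal.ofReal_mul (by norm_num), ← h4]
        norm_num

/-- The squared `L²` error in terms of the tail mass and of the residuals at the nodes. -/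
theorem sqL2Dist_mixtureDensity_le (hd : 1 ≤ d) (hσ : 0 < σmin) (hb : 0 < bmin)
    (hg0 : ∀ᵐ x, 0 ≤ g x) (hg : Integrable g) (hg1 : ∫ x, g x = 1) (hR : 0 < R) {L : ℝ≥0}
    (hL : LipschitzOnWith L (densityCF g) (Metric.closedBall 0 (√d * R)))
    {ε : ℝ} (hε : 0 ≤ ε) (hG : tailMass (densityCF g) R ≤ ENNReal.ofReal ε) {θ : Param d KG KL}
    (hθ : θ ∈ paramSet d KG KL μbar σmin σmax bmin bmax)
    (hH : tailMass (mixtureCF θ) R ≤ ENNReal.ofReal ε) (Γ : TensorGrid d n R) :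
    sqL2Dist g (mixtureDensity θ) ≤ ENNReal.ofReal (1 / (2 * Real.pi) ^ d *
      (4 * ε + (n * Γ.maxWidth) ^ d *
        (Γ.mean (fun η ↦ ‖densityCF g η - mixtureCF θ η‖ ^ 2) +
          4 * (L + (|μbar| + 2 * (√d * R) * (σmax ^ 2 + bmax ^ 2))) * √d * Γ.maxWidth))) := by
  have hn := Γ.pos_of_pos hd hR
  have hw := Γ.maxWidth_pos hd hR
  have hPG := posDef_covG hσ hθ
  have hPL := posDef_covL hb hθ
  rw [sqL2Dist_eq_lintegral_densityCF hg (integrable_mixtureDensity hd hPG hPL),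
    ENNReal.ofReal_mul (by positivity)]
  simp_rw [densityCF_mixtureDensity hd hPG hPL]
  refine mul_le_mul_right ?_ _
  -- The tail accounts for 4ε and the cube for the Riemann sum; the Lipschitz constants are those on
  -- the ball of radius √d R, which contains the cube.
  rw [← lintegral_add_compl _ (measurableSet_cube R), add_comm, ENNReal.ofReal_add (by positivity)]
  · refine add_le_add (tailMass_sub_le (continuous_densityCF hg) hG hH) ?_
    refine Γ.setLIntegral_cube_le hn (by positivity) hw.le (fun η ↦ ?_) fun u hu v hv ↦ ?_
    · have h1 := norm_densityCF_le_one hg0 hg1 η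
      have h2 := norm_mixtureCF_le_one hθ η
      linarith [norm_sub_le (densityCF g η) (mixtureCF θ η)]
    · have hu' := norm_le_of_mem_cube hR.le hu
      have hv' := norm_le_of_mem_cube hR.le hv
      have h1 := hL.norm_sub_le (mem_closedBall_zero_iff.2 hu') (mem_closedBall_zero_iff.2 hv')
      have h2 := norm_mixtureCF_sub_le hσ hb hθ hu' hv'
      have h3 := norm_sub_le (densityCF g u - densityCF g v) (mixtureCF θ u - mixtureCF θ v)
      rw [sub_sub_sub_comm, add_mul]
      linarith
  · have := Γ.mean_nonneg (f := fun η ↦ ‖densityCF g η - mixtureCF θ η‖ ^ 2) fun _ ↦ by positivity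
    positivity

/-- The residual is split through the empirical characteristic function with |a - b|² ≤ 2|a|² +
2|b|². The absolute-error part of the loss is nonnegative, so the squared part alone is at most ε₁.
-/
lemma mean_norm_sub_sq_le_of_trainLoss_le (Γ : TensorGrid d n R) {lam ε₁ : ℝ} (hlam : 0 ≤ lam)
    {x : Fin M → Vec d} {θ : Param d KG KL} (h : trainLoss Γ lam x θ ≤ ε₁) (G : Vec d → ℂ) :
    Γ.mean (fun η ↦ ‖G η - mixtureCF θ η‖ ^ 2) ≤
      2 * Γ.mean (fun η ↦ ‖G η - empiricalCF x η‖ ^ 2) + 2 * ε₁ := by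
  have h1 : Γ.mean (fun η ↦ ((empiricalCF x η).re - (mixtureCF θ η).re) ^ 2 +
      ((empiricalCF x η).im - (mixtureCF θ η).im) ^ 2) ≤ ε₁ := by
    have := mul_nonneg hlam (Γ.mean_nonneg (f := fun η ↦
      |(empiricalCF x η).re - (mixtureCF θ η).re| +
        |(empiricalCF x η).im - (mixtureCF θ η).im|) fun _ ↦ by positivity)
    rw [trainLoss] at h
    linarith
  refine le_trans ?_ (add_le_add_right (mul_le_mul_of_nonneg_left h1 two_pos.le) _)
  rw [← Γ.mean_const_mul, ← Γ.mean_const_mul, ← Γ.mean_add]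
  refine Γ.mean_mono fun p ↦ ?_
  set η := Γ.nodeVec p
  have h2 := norm_sub_sq_le (G η - empiricalCF x η) (mixtureCF θ η - empiricalCF x η)
  rw [sub_sub_sub_cancel_right] at h2
  refine h2.trans (le_of_eq ?_)
  rw [Complex.sq_norm (mixtureCF θ η - _), Complex.normSq_apply, Complex.sub_re, Complex.sub_im]
  ring

variable {Ω : Type*} [MeasurableSpace Ω] {Pr : Measure Ω}

lemma integrable_norm_densityCF_sub_empiricalCF_sq [IsProbabilityMeasure Pr]
    (hg0 : ∀ᵐ x, 0 ≤ g x) (hg1 : ∫ x, g x = 1)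
    {X : Fin M → Ω → Vec d} (hX : ∀ m, AEMeasurable (X m) Pr) (η : Vec d) :
    Integrable (fun ω ↦ ‖densityCF g η - empiricalCF (fun m ↦ X m ω) η‖ ^ 2) Pr := by
  refine .of_bound (((aemeasurable_empiricalCF hX η).const_sub _).norm.pow_const
    2).aestronglyMeasurable (2 ^ 2) (ae_of_all _ fun ω ↦ ?_)
  rw [Real.norm_of_nonneg (by positivity)]
  refine pow_le_pow_left₀ (norm_nonneg _) ?_ 2
  have h1 := norm_densityCF_le_one hg0 hg1 η
  have h2 := norm_empiricalCF_le_one (fun m ↦ X m ω) η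
  linarith [norm_sub_le (densityCF g η) (empiricalCF (fun m ↦ X m ω) η)]

lemma integrable_mean (Γ : TensorGrid d n R) {f : Vec d → Ω → ℝ} (hf : ∀ η, Integrable (f η) Pr) :
    Integrable (fun ω ↦ Γ.mean fun η ↦ f η ω) Pr :=
  (integrable_finsetSum _ fun p _ ↦ hf (Γ.nodeVec p)).const_mul _

lemma integral_mean (Γ : TensorGrid d n R) {f : Vec d → Ω → ℝ} (hf : ∀ η, Integrable (f η) Pr) :
    ∫ ω, Γ.mean (fun η ↦ f η ω) ∂Pr = Γ.mean fun η ↦ ∫ ω, f η ω ∂Pr := by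
  simp only [TensorGrid.mean]
  rw [integral_const_mul, integral_finsetSum _ fun p _ ↦ hf (Γ.nodeVec p)]

theorem integral_mean_norm_densityCF_sub_empiricalCF_sq [IsProbabilityMeasure Pr]
    (hg0 : ∀ᵐ x, 0 ≤ g x) (hg : Integrable g)
    (hg1 : ∫ x, g x = 1) (Γ : TensorGrid d n R) (hM : 0 < M) {X : Fin M → Ω → Vec d}
    (hX : ∀ m, AEMeasurable (X m) Pr) (hind : iIndepFun X Pr)
    (hlaw : ∀ m, Pr.map (X m) = volume.withDensity (fun x ↦ ENNReal.ofReal (g x))) :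
    ∫ ω, Γ.mean (fun η ↦ ‖densityCF g η - empiricalCF (fun m ↦ X m ω) η‖ ^ 2) ∂Pr =
      gridV Γ (densityCF g) / M := by
  rw [integral_mean Γ (integrable_norm_densityCF_sub_empiricalCF_sq hg0 hg1 hX)]
  simp_rw [integral_norm_densityCF_sub_empiricalCF_sq hg0 hg hM hX hind hlaw, div_eq_inv_mul]
  rw [Γ.mean_const_mul, gridV]

lemma gridV_mem_Icc (Γ : TensorGrid d n R) (hn : 0 < n) {G : Vec d → ℂ} (hG : ∀ η, ‖G η‖ ≤ 1) :
    0 ≤ gridV Γ G ∧ gridV Γ G ≤ 1 := by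
  refine ⟨Γ.mean_nonneg fun η ↦ sub_nonneg.2 (pow_le_one₀ (norm_nonneg _) (hG η)), ?_⟩
  refine (Γ.mean_mono (h := fun _ ↦ 1) fun p ↦ ?_).trans_eq (Γ.mean_const hn 1)
  exact sub_le_self _ (by positivity)

lemma gridW_mem_Icc (Γ : TensorGrid d n R) (hn : 0 < n) (G : Vec d → ℂ) :
    0 ≤ gridW Γ G ∧ gridW Γ G ≤ 1 := by
  refine ⟨Γ.mean_nonneg fun η ↦ Real.sqrt_nonneg _, ?_⟩
  refine (Γ.mean_mono (h := fun _ ↦ 1) fun p ↦ ?_).trans_eq (Γ.mean_const hn 1)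
  exact Real.sqrt_le_one.2 (sub_le_self _ (by positivity))

/-- The expected squared `L²` error of any estimator whose training loss is at most `ε₁`. -/
theorem lintegral_sqL2Dist_le [IsProbabilityMeasure Pr] (hd : 1 ≤ d) (hσ : 0 < σmin) (hb : 0 < bmin)
    (hg0 : ∀ᵐ x, 0 ≤ g x) (hg : Integrable g) (hg1 : ∫ x, g x = 1) (hR : 0 < R) {L : ℝ≥0}
    (hL : LipschitzOnWith L (densityCF g) (Metric.closedBall 0 (√d * R)))
    {ε : ℝ} (hε : 0 ≤ ε) (hG : tailMass (densityCF g) R ≤ ENNReal.ofReal ε)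
    (hH : ∀ θ ∈ paramSet d KG KL μbar σmin σmax bmin bmax,
      tailMass (mixtureCF θ) R ≤ ENNReal.ofReal ε) (Γ : TensorGrid d n R) (hM : 0 < M)
    {lam ε₁ : ℝ} (hlam : 0 ≤ lam) (hε₁ : 0 ≤ ε₁) {X : Fin M → Ω → Vec d}
    (hX : ∀ m, AEMeasurable (X m) Pr) (hind : iIndepFun X Pr)
    (hlaw : ∀ m, Pr.map (X m) = volume.withDensity (fun x ↦ ENNReal.ofReal (g x)))
    {θhat : Ω → Param d KG KL}
    (hθ : ∀ᵐ ω ∂Pr, θhat ω ∈ paramSet d KG KL μbar σmin σmax bmin bmax ∧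
      trainLoss Γ lam (fun m ↦ X m ω) (θhat ω) ≤ ε₁) :
    ∫⁻ ω, sqL2Dist g (mixtureDensity (θhat ω)) ∂Pr ≤ ENNReal.ofReal (1 / (2 * Real.pi) ^ d *
      (4 * ε + (n * Γ.maxWidth) ^ d * (2 * (gridV Γ (densityCF g) / M) + 2 * ε₁ +
          4 * (L + (|μbar| + 2 * (√d * R) * (σmax ^ 2 + bmax ^ 2))) * √d * Γ.maxWidth))) := by
  have hw := (Γ.maxWidth_pos hd hR).le
  set A := 4 * (L + (|μbar| + 2 * (√d * R) * (σmax ^ 2 + bmax ^ 2))) * √d * Γ.maxWidth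
  have hA : 0 ≤ A := by positivity
  set Q : Ω → ℝ := fun ω ↦
    Γ.mean fun η ↦ ‖densityCF g η - empiricalCF (fun m ↦ X m ω) η‖ ^ 2
  have hQ0 : ∀ ω, 0 ≤ Q ω := fun ω ↦ Γ.mean_nonneg fun _ ↦ by positivity
  have hQi : Integrable Q Pr :=
    integrable_mean Γ (integrable_norm_densityCF_sub_empiricalCF_sq hg0 hg1 hX)
  have hi1 : Integrable (fun ω ↦ 2 * Q ω + (2 * ε₁ + A)) Pr :=
    (hQi.const_mul 2).add (integrable_const _)
  have hi2 : Integrable (fun ω ↦ (n * Γ.maxWidth) ^ d * (2 * Q ω + (2 * ε₁ + A))) Pr :=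
    hi1.const_mul _
  have hi3 : Integrable (fun ω ↦ 1 / (2 * Real.pi) ^ d *
      (4 * ε + (n * Γ.maxWidth) ^ d * (2 * Q ω + (2 * ε₁ + A)))) Pr :=
    ((integrable_const _).add hi2).const_mul _
  calc ∫⁻ ω, sqL2Dist g (mixtureDensity (θhat ω)) ∂Pr
      ≤ ∫⁻ ω, ENNReal.ofReal (1 / (2 * Real.pi) ^ d *
          (4 * ε + (n * Γ.maxWidth) ^ d * (2 * Q ω + (2 * ε₁ + A)))) ∂Pr := by
        -- The estimator enters only through this pointwise comparison with a function of the
        -- sample, so the selection `θhat` need not be measurable.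
        refine lintegral_mono_ae ?_
        filter_upwards [hθ] with ω hω
        refine (sqL2Dist_mixtureDensity_le hd hσ hb hg0 hg hg1 hR hL hε hG hω.1 (hH _ hω.1)
          Γ).trans (ENNReal.ofReal_le_ofReal ?_)
        have h := mean_norm_sub_sq_le_of_trainLoss_le Γ hlam hω.2 (densityCF g)
        change _ ≤ 2 * Q ω + 2 * ε₁ at h
        have h' := add_le_add_left h A
        rw [add_assoc] at h'
        gcongr
    _ = ENNReal.ofReal (∫ ω, 1 / (2 * Real.pi) ^ d *
          (4 * ε + (n * Γ.maxWidth) ^ d * (2 * Q ω + (2 * ε₁ + A))) ∂Pr) := by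
        refine (ofReal_integral_eq_lintegral_ofReal hi3 (ae_of_all _ fun ω ↦ ?_)).symm
        have := hQ0 ω
        simp only [Pi.zero_apply]
        positivity
    _ = _ := by
        have hQ : ∫ ω, Q ω ∂Pr = gridV Γ (densityCF g) / M :=
          integral_mean_norm_densityCF_sub_empiricalCF_sq hg0 hg hg1 Γ hM hX hind hlaw
        rw [integral_const_mul (1 / (2 * Real.pi) ^ d), integral_add (integrable_const _) hi2,
          integral_const_mul ((n * Γ.maxWidth) ^ d),
          integral_add (hQi.const_mul 2) (integrable_const _), integral_const_mul 2, hQ]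
        simp only [integral_const, probReal_univ, one_smul]
        ring_nf

end ErrorBound

end FourierMixture

/-! ### The main theorem -/

theorem mainTheorem3
    (d : ℕ) (hd : 1 ≤ d) (KG KL : ℕ)
    (g : FourierMixture.Vec d → ℝ)
    (hg_nonneg : ∀ᵐ x, 0 ≤ g x) (hg_int : Integrable g) (hg_one : ∫ x, g x = 1)
    (hg_bdd : MemLp g ∞ volume)
    (hG_lip : ∀ K : Set (FourierMixture.Vec d), IsCompact K →
      ∃ L : ℝ≥0, LipschitzOnWith L (FourierMixture.densityCF g) K)
    (μbar σmin σmax bmin bmax : ℝ) (hσ : 0 < σmin) (hb : 0 < bmin) :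
    -- the tail condition below can be met for all large `η'` when `d ≤ 3` or `KL = 0`
    ((d ≤ 3 ∨ KL = 0) → ∀ ε : ℝ, 0 < ε → ∃ η₀ : ℝ, 0 < η₀ ∧ ∀ η' : ℝ, η₀ ≤ η' →
      FourierMixture.tailMass (FourierMixture.densityCF g) η' ≤ ENNReal.ofReal ε ∧
      ∀ θ ∈ FourierMixture.paramSet d KG KL μbar σmin σmax bmin bmax,
        FourierMixture.tailMass (FourierMixture.mixtureCF θ) η' ≤ ENNReal.ofReal ε) ∧
    -- the error bound
    ∀ η' : ℝ, 0 < η' → ∃ C' : ℝ, 0 < C' ∧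
      ∀ ε : ℝ, 0 < ε →
      FourierMixture.tailMass (FourierMixture.densityCF g) η' ≤ ENNReal.ofReal ε →
      (∀ θ ∈ FourierMixture.paramSet d KG KL μbar σmin σmax bmin bmax,
        FourierMixture.tailMass (FourierMixture.mixtureCF θ) η' ≤ ENNReal.ofReal ε) →
      ∀ (P n : ℕ), P = n ^ d →
      ∀ (Γ : FourierMixture.TensorGrid d n η') (C₁ : ℝ),
      Γ.maxWidth = C₁ / (P : ℝ) ^ (1 / (d : ℝ)) →
      ∀ (M : ℕ), 0 < M → ∀ lam : ℝ, 0 ≤ lam → ∀ ε₁ : ℝ, 0 < ε₁ →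
      ∀ (Ω : Type*) [MeasurableSpace Ω] (Pr : Measure Ω) [IsProbabilityMeasure Pr]
        (X : Fin M → Ω → FourierMixture.Vec d),
      (∀ m, AEMeasurable (X m) Pr) → iIndepFun X Pr →
      (∀ m, Pr.map (X m) = volume.withDensity (fun x => ENNReal.ofReal (g x))) →
      ∀ (Θhat : Set (FourierMixture.Param d KG KL)),
      Θhat ⊆ FourierMixture.paramSet d KG KL μbar σmin σmax bmin bmax →
      ∀ (θhat : Ω → FourierMixture.Param d KG KL),
      (∀ᵐ ω ∂Pr, θhat ω ∈ Θhat ∧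
        IsMinOn (FourierMixture.trainLoss Γ lam (fun m => X m ω)) Θhat (θhat ω) ∧
        FourierMixture.trainLoss Γ lam (fun m => X m ω) (θhat ω) ≤ ε₁) →
      ∫⁻ ω, FourierMixture.sqL2Dist g (FourierMixture.mixtureDensity (θhat ω)) ∂Pr <
        ENNReal.ofReal (1 / (2 * Real.pi) ^ d *
          (4 * ε +
            C₁ ^ d * (2 * ε₁ + 2 * FourierMixture.gridV Γ (FourierMixture.densityCF g) / M +
              lam * Real.sqrt (2 / M) * FourierMixture.gridW Γ (FourierMixture.densityCF g)) +
            C' * C₁ ^ (d + 1) / (P : ℝ) ^ (1 / (d : ℝ)))) ∧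
      (0 ≤ FourierMixture.gridV Γ (FourierMixture.densityCF g) ∧
        FourierMixture.gridV Γ (FourierMixture.densityCF g) ≤ 1) ∧
      (0 ≤ FourierMixture.gridW Γ (FourierMixture.densityCF g) ∧
        FourierMixture.gridW Γ (FourierMixture.densityCF g) ≤ 1) ∧
      ∫⁻ ω, FourierMixture.sqL2Dist g (FourierMixture.mixtureDensity (θhat ω)) ∂Pr <
        ENNReal.ofReal (1 / (2 * Real.pi) ^ d *
          (4 * ε +
            C₁ ^ d * (2 * ε₁ + 2 / M + lam * Real.sqrt (2 / M)) +
            C' * C₁ ^ (d + 1) / (P : ℝ) ^ (1 / (d : ℝ)))) := by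

  refine ⟨fun h ε hε ↦ FourierMixture.exists_tailMass_le hσ hb hg_int hg_bdd h hε,
    fun R hR ↦ ?_⟩
  obtain ⟨L, hL⟩ := hG_lip _ (isCompact_closedBall 0 (√d * R))
  set A := 4 * (L + (|μbar| + 2 * (√d * R) * (σmax ^ 2 + bmax ^ 2))) * √d with hA
  have hA0 : 0 ≤ A := by positivity
  -- A is the mesh constant of the non-strict bound; it involves only `η'`, d, the Lipschitz
  -- constant of G and the parameter bounds. The extra 1 leaves room for strict inequality.
  refine ⟨A + 1, by positivity, ?_⟩
  intro ε hε hG hH P n hP Γ C₁ hC₁ M hM lam hlam ε₁ hε₁ Ω _ Pr _ X hX hind hlaw Θhat hΘ θhat hθ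
  have hn := Γ.pos_of_pos hd hR
  have hw := Γ.maxWidth_pos hd hR
  have hPn : (P : ℝ) ^ (1 / (d : ℝ)) = n := by
    rw [hP, Nat.cast_pow, one_div, Real.pow_rpow_inv_natCast (Nat.cast_nonneg n) (by omega)]
  have hn0 : (0 : ℝ) < n := by exact_mod_cast hn
  rw [hPn] at hC₁ ⊢
  -- As P^(1/d) = n, the factor (n δ)^d of the Riemann sum is exactly C₁^d.
  have hC : n * Γ.maxWidth = C₁ := by
    rw [hC₁]
    field_simp
  have hC0 : 0 < C₁ := hC ▸ mul_pos hn0 hw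
  have hV := FourierMixture.gridV_mem_Icc Γ hn
    (FourierMixture.norm_densityCF_le_one hg_nonneg hg_one)
  have hW := FourierMixture.gridW_mem_Icc Γ hn (FourierMixture.densityCF g)
  have hbound := FourierMixture.lintegral_sqL2Dist_le hd hσ hb hg_nonneg hg_int hg_one hR hL hε.le
    hG hH Γ hM hlam hε₁.le hX hind hlaw (hθ.mono fun ω hω ↦ ⟨hΘ hω.1, hω.2.2⟩)
  rw [← hA, hC, hC₁] at hbound
  set V := FourierMixture.gridV Γ (FourierMixture.densityCF g)
  set W := FourierMixture.gridW Γ (FourierMixture.densityCF g)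
  have hM0 : (0 : ℝ) < M := by exact_mod_cast hM
  have hs : 0 ≤ lam * √(2 / M) := by positivity
  have hlt : 1 / (2 * Real.pi) ^ d *
        (4 * ε + C₁ ^ d * (2 * (V / M) + 2 * ε₁ + A * (C₁ / n))) <
      1 / (2 * Real.pi) ^ d *
        (4 * ε + C₁ ^ d * (2 * ε₁ + 2 * V / M + lam * √(2 / M) * W) +
          (A + 1) * C₁ ^ (d + 1) / n) := by
    refine mul_lt_mul_of_pos_left ?_ (by positivity)
    have h1 : 0 ≤ C₁ ^ d * (lam * √(2 / M) * W) :=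
      mul_nonneg (by positivity) (mul_nonneg hs hW.1)
    -- This is the gain from A + 1; together with the nonnegative W-term it is the whole difference
    -- of the two sides.
    have h2 : 0 < C₁ ^ (d + 1) / n := by positivity
    have h3 : 4 * ε + C₁ ^ d * (2 * ε₁ + 2 * V / M + lam * √(2 / M) * W) +
        (A + 1) * C₁ ^ (d + 1) / n =
      4 * ε + C₁ ^ d * (2 * (V / M) + 2 * ε₁ + A * (C₁ / n)) +
        C₁ ^ d * (lam * √(2 / M) * W) + C₁ ^ (d + 1) / n := by
      ring
    linarith
  have hle : 1 / (2 * Real.pi) ^ d *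
        (4 * ε + C₁ ^ d * (2 * ε₁ + 2 * V / M + lam * √(2 / M) * W) +
          (A + 1) * C₁ ^ (d + 1) / n) ≤
      1 / (2 * Real.pi) ^ d *
        (4 * ε + C₁ ^ d * (2 * ε₁ + 2 / M + lam * √(2 / M)) +
          (A + 1) * C₁ ^ (d + 1) / n) := by
    have h1 : 2 * V / M ≤ 2 / M := by
      gcongr
      linarith [hV.2]
    have h2 : lam * √(2 / M) * W ≤ lam * √(2 / M) := mul_le_of_le_one_right hs hW.2
    gcongr
  have hpos : 0 < 1 / (2 * Real.pi) ^ d *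
        (4 * ε + C₁ ^ d * (2 * ε₁ + 2 * V / M + lam * √(2 / M) * W) +
          (A + 1) * C₁ ^ (d + 1) / n) := by
    refine lt_of_le_of_lt ?_ hlt
    have := hV.1
    positivity
  have hfirst := hbound.trans_lt ((ENNReal.ofReal_lt_ofReal_iff hpos).2 hlt)
  exact ⟨hfirst, hV, hW, hfirst.trans_le (ENNReal.ofReal_le_ofReal hle)⟩
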